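/- For $k\ge 1$ let $M_k$ be the complex vector space of complex $k\times k$ matrices. For $0<r<\infty$ let $S_r^k$ be $M_k$ with the Schatten (quasi-)norm $\|X\|_r=\big(\operatorname{Tr}|X|^r\big)^{1/r}$, where $|X|=(X^*X)^{1/2}$, and let $S_\infty^k$ be $M_k$ with the operator norm $\|X\|_\infty$ on $\ell_2^k$. An isometric embedding of $S_q^m$ into $S_p^n$ is a complex-linear map $T:M_m\to M_n$ with $\|T(X)\|_p=\|X\|_q$ for all $X\in M_m$. Theorem 1.2. Let $0<p<1$ and let $2\le m\le n$ be integers. (1) If $q\in(0,2)\setminus\{1\}$ and $q\neq p$, then there is no isometric embedding of $S_q^m$ into $S_p^n$. (2) If $2\le q<\infty$, then there is no isometric embedding $T$ of $S_q^m$ into $S_p^n$ such that $A=T(\operatorname{diag}(1,0,\dots,0))$ and $B=T(\operatorname{diag}(0,1,0,\dots,0))$ are both self-adjoint and either $A\ge 0$ or $A\le 0$ (that is, $A$ or $-A$ is positive semidefinite). (3) If $p\notin\{1/k:k\in\mathbb N,\ k\ge 1\}$, then there is no isometric embedding of $S_1^m$ into $S_p^n$. (4) If $p\notin\{1/k:k\in\mathbb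 N,\ k\ge 1\}$, then there is no isometric embedding of $S_\infty^m$ into $S_p^n$. -/

import Mathlib

open scoped ENNReal ComplexOrder

noncomputable section

open scoped MatrixOrder in
/-- The Schatten `p`-(quasi-)norm of a complex square matrix: `(Tr |A| ^ p) ^ (1 / p)` for
`0 < p < ∞`, where `|A| = (Aᴴ A) ^ (1 / 2)`, and the operator norm of `A` on the Euclidean space
for `p = ∞`. (The value at `p = 0` is irrelevant.) -/
def schattenNorm {n : ℕ} (p : ℝ≥0∞) (A : Matrix (Fin n) (Fin n) ℂ) : ℝ :=
  if p = ∞ then ‖Matrix.toEuclideanCLM (n := Fin n) (𝕜 := ℂ) A‖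
  else (Matrix.trace (CFC.abs A ^ p.toReal)).re ^ (1 / p.toReal)

/-- The linear map `T` is an isometric embedding of `S_q^m` into `S_p^n`. -/
def IsSchattenIsometry {m n : ℕ} (q p : ℝ≥0∞)
    (T : Matrix (Fin m) (Fin m) ℂ →ₗ[ℂ] Matrix (Fin n) (Fin n) ℂ) : Prop :=
  ∀ X, schattenNorm p (T X) = schattenNorm q X

/-- The diagonal matrix unit of size `m` with entry `1` at the (zero-based) position `j`. -/
def diagUnit (m j : ℕ) : Matrix (Fin m) (Fin m) ℂ :=
  Matrix.diagonal fun i => if (i : ℕ) = j then 1 else 0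

end

open Matrix Filter Topology

variable {m n : ℕ}

/-! Only the images `A` and `B` of the first two diagonal units are used. On their span the isometry
prescribes `F z = ∑ σ_i(A + z • B) ^ p`: it is `(1 + |z|^q)^(p/q)` for finite `q` and `(max 1
|z|)^p` for `q = ∞`. The obstruction is that the singular values of a linear pencil have leading
monomials `c_k |z|^(e_k)` with integer exponents.

The product of the `k` largest singular values is the maximum of `|det (Wᴴ (A + z • B) U)|` over
isometries `W`, `U`, hence a maximum of moduli of polynomials over a compact family. So it behaves
like `γ |z|^d` at `0`, and quotients of consecutive products give `c_k` and `e_k`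
(`nonempty_pencilExpansion`). Two bounds then enclose `F`. From below, the mean value property of
`log |P|` yields on every small circle a point where `F` is at least the sum of the `p`-th powers of
the monomials. From above, averaging over `t` and `-t` removes the first-order change of the
singular values that are nonzero at `0`, leaving `O(t^2)`. Hence growth of `F` of order `t^κ` with
`κ < 2` must come from small singular values with `p * e_k = κ` (`le_coeffAt`), and a bound `O(t^κ)`
forces `κ ≤ p * e_k` (`le_exponent`).

For `q < 2` the growth is `(p/q) t^q`. If `q < p`, no positive integer `e` solves `p * e = q`. If `q
> p`, the lower bound contradicts the strict Bernoulli inequality for the exponent `p/q < 1`. For `q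
= ∞` the kink of `max 1 |z|` at `z = 1` has growth of order `t`, which forces `1/p` to be an
integer.

For `q ≥ 2` with `A ≥ 0`, every small exponent is at least `3`. Compressed determinants then show
that `B` vanishes on `ker A`. An eigenvalue of `A^(-1/2) B A^(-1/2)` gives a real `t ≠ 0` such that
`A + t • B` has a kernel vector on which the form of `B` is nonzero, hence a singular value
vanishing there to order at most one. But `F` grows at most linearly near `t`, which forces `p * e ≥
1` and so `e ≥ 2`. -/

/-! ### Ordered singular values and traces of spectral functions -/

theorem trace_cfc_hermitian {ι : Type*} [Fintype ι] [DecidableEq ι] {X : Matrix ι ι ℂ}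
    (hX : X.IsHermitian) (f : ℝ → ℝ) :
    (cfc f X).trace = ∑ i, (f (hX.eigenvalues i) : ℂ) := by
  rw [hX.cfc_eq, IsHermitian.cfc, Unitary.conjStarAlgAut_apply, trace_mul_cycle]
  simp [trace_diagonal]

/-- A single existence statement keeps the decreasing order, the trace formula and the adapted
orthonormal basis compatible. The order comes from `eigenvalues₀` and the spectral theorem from
`eigenvalues`; the permutation `e` reconciles them. The tail of zeros makes the order a statement on
all of `ℕ`. -/
theorem exists_singularBasis {n : ℕ} (M : Matrix (Fin n) (Fin n) ℂ) :
    ∃ σ : ℕ → ℝ, Antitone σ ∧ (∀ j, 0 ≤ σ j) ∧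
      (∀ f : ℝ → ℝ, (cfc f (Mᴴ * M)).trace = ∑ i : Fin n, (f (σ i ^ 2) : ℂ)) ∧
      ∃ V : Matrix (Fin n) (Fin n) ℂ, Vᴴ * V = 1 ∧
        Vᴴ * (Mᴴ * M) * V = diagonal fun i : Fin n => ((σ i ^ 2 : ℝ) : ℂ) := by
  have hP := posSemidef_conjTranspose_mul_self M
  have hX := hP.isHermitian
  let e : Fin n ≃ Fin n :=
    (finCongr (Fintype.card_fin n).symm).trans (Fintype.equivOfCardEq (Fintype.card_fin _))
  let σ : ℕ → ℝ := fun j =>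
    if h : j < Fintype.card (Fin n) then √(hX.eigenvalues₀ ⟨j, h⟩) else 0
  have h0 : ∀ i : Fin n, hX.eigenvalues (e i) = σ i ^ 2 := by
    intro i
    have hi : (i : ℕ) < Fintype.card (Fin n) := by simp
    have h1 : hX.eigenvalues (e i) = hX.eigenvalues₀ ⟨i, hi⟩ := by
      simp only [IsHermitian.eigenvalues, e, Equiv.trans_apply, Equiv.symm_apply_apply]
      rfl
    have h2 : 0 ≤ hX.eigenvalues₀ ⟨i, hi⟩ := h1 ▸ hP.eigenvalues_nonneg _
    simp only [σ, dif_pos hi, Real.sq_sqrt h2, h1]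
  refine ⟨σ, ?_, ?_, ?_, ?_⟩
  · intro a b hab
    by_cases hb : b < Fintype.card (Fin n)
    · simp only [σ, dif_pos hb, dif_pos (hab.trans_lt hb)]
      exact Real.sqrt_le_sqrt (hX.eigenvalues₀_antitone hab)
    · simp only [σ, dif_neg hb]
      split_ifs <;> positivity
  · intro j
    simp only [σ]
    split_ifs <;> positivity
  · intro f
    rw [trace_cfc_hermitian hX, ← e.sum_comp]
    simp_rw [h0]
  · set E : Matrix (Fin n) (Fin n) ℂ := hX.eigenvectorUnitary.1 with hE
    have hU : Eᴴ * E = 1 := Unitary.coe_star_mul_self hX.eigenvectorUnitary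
    refine ⟨E.submatrix id e, ?_, ?_⟩
    · ext i j
      have := congrFun (congrFun hU (e i)) (e j)
      simpa [Matrix.mul_apply, one_apply] using this
    · have h := hX.spectral_theorem
      rw [Unitary.conjStarAlgAut_apply, ← hE, star_eq_conjTranspose] at h
      have h3 : Eᴴ * (Mᴴ * M) * E = diagonal (RCLike.ofReal ∘ hX.eigenvalues) := by
        calc _ = (Eᴴ * E) * diagonal (RCLike.ofReal ∘ hX.eigenvalues) * (Eᴴ * E) :=
                (congrArg (fun Z => Eᴴ * Z * E) h).trans (by simp only [Matrix.mul_assoc])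
          _ = _ := by rw [hU]; simp
      ext i j
      have h4 := congrFun (congrFun h3 (e i)) (e j)
      have h5 : ((E.submatrix id e)ᴴ * (Mᴴ * M) * E.submatrix id e) i j =
          (Eᴴ * (Mᴴ * M) * E) (e i) (e j) := by
        simp [Matrix.mul_apply]
      rw [h5, h4]
      simp [diagonal_apply, h0]

/-- The singular values of a square complex matrix in decreasing order, continued by zero. -/
noncomputable def singVal {n : ℕ} (M : Matrix (Fin n) (Fin n) ℂ) : ℕ → ℝ :=
  (exists_singularBasis M).choose

theorem singVal_antitone (M : Matrix (Fin n) (Fin n) ℂ) : Antitone (singVal M) :=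
  (exists_singularBasis M).choose_spec.1

theorem singVal_nonneg (M : Matrix (Fin n) (Fin n) ℂ) (j : ℕ) : 0 ≤ singVal M j :=
  (exists_singularBasis M).choose_spec.2.1 j

theorem trace_cfc_eq_sum_singVal (M : Matrix (Fin n) (Fin n) ℂ) (f : ℝ → ℝ) :
    (cfc f (Mᴴ * M)).trace = ∑ i : Fin n, (f (singVal M i ^ 2) : ℂ) :=
  (exists_singularBasis M).choose_spec.2.2.1 f

theorem exists_singVal_basis (M : Matrix (Fin n) (Fin n) ℂ) :
    ∃ V : Matrix (Fin n) (Fin n) ℂ, Vᴴ * V = 1 ∧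
      Vᴴ * (Mᴴ * M) * V = diagonal fun i : Fin n => ((singVal M i ^ 2 : ℝ) : ℂ) :=
  (exists_singularBasis M).choose_spec.2.2.2

open scoped MatrixOrder in
theorem abs_rpow_eq_cfc (M : Matrix (Fin n) (Fin n) ℂ) {p : ℝ} (hp : 0 < p) :
    CFC.abs M ^ p = cfc (fun x : ℝ => √x ^ p) (Mᴴ * M) := by
  have hX : (0 : Matrix (Fin n) (Fin n) ℂ) ≤ Mᴴ * M :=
    (posSemidef_conjTranspose_mul_self M).nonneg
  rw [CFC.rpow_eq_cfc_real (CFC.abs_nonneg M), CFC.abs, star_eq_conjTranspose,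
    CFC.sqrt_eq_real_sqrt _ hX, cfcₙ_eq_cfc,
    ← cfc_comp (fun x : ℝ => x ^ p) Real.sqrt (Mᴴ * M) hX.isSelfAdjoint
      (Real.continuous_rpow_const hp.le).continuousOn]
  rfl

open scoped MatrixOrder in
theorem trace_abs_rpow (M : Matrix (Fin n) (Fin n) ℂ) {p : ℝ} (hp : 0 < p) :
    (CFC.abs M ^ p).trace.re = ∑ i : Fin n, singVal M i ^ p := by
  rw [abs_rpow_eq_cfc M hp, trace_cfc_eq_sum_singVal]
  simp [Real.sqrt_sq, singVal_nonneg, ← Complex.ofReal_sum]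

/-- Diagonal entries and eigenvalues are both the roots of the characteristic polynomial, so they
agree as multisets, which is all a trace sees. -/
theorem trace_cfc_diagonal {ι : Type*} [Fintype ι] [DecidableEq ι] (x : ι → ℝ) (f : ℝ → ℝ) :
    (cfc f (diagonal fun i => (x i : ℂ))).trace = ∑ i, (f (x i) : ℂ) := by
  have hX : (diagonal fun i => (x i : ℂ)).IsHermitian :=
    isHermitian_diagonal_of_self_adjoint _ (by ext i; simp)
  have h1 : Multiset.map (fun i => (hX.eigenvalues i : ℂ)) Finset.univ.val =
      Multiset.map (fun i => (x i : ℂ)) Finset.univ.val := by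
    have h2 := hX.roots_charpoly_eq_eigenvalues
    rw [charpoly_diagonal, Polynomial.roots_prod _ _
      (Finset.prod_ne_zero_iff.mpr fun i _ => Polynomial.X_sub_C_ne_zero _)] at h2
    simp only [Polynomial.roots_X_sub_C, Multiset.bind_singleton] at h2
    exact h2.symm
  have h3 := congrArg (fun s : Multiset ℂ => (s.map fun z => (f z.re : ℂ)).sum) h1
  rw [trace_cfc_hermitian hX]
  simpa [Multiset.map_map] using h3

open scoped MatrixOrder in
theorem trace_abs_rpow_diagonal (d : Fin n → ℂ) {p : ℝ} (hp : 0 < p) :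
    (CFC.abs (diagonal d) ^ p).trace.re = ∑ i, ‖d i‖ ^ p := by
  have h : (diagonal d)ᴴ * diagonal d = diagonal fun i => ((‖d i‖ ^ 2 : ℝ) : ℂ) := by
    rw [diagonal_conjTranspose, diagonal_mul_diagonal]
    congr 1
    funext i
    simp [Complex.conj_mul']
  rw [abs_rpow_eq_cfc _ hp, h, trace_cfc_diagonal]
  simp [← Complex.ofReal_sum]

/-! ### Lengths of vectors and the Courant–Fischer comparison -/

/-- The squared Euclidean length of a vector. -/
noncomputable def nsq {ι : Type*} [Fintype ι] (x : ι → ℂ) : ℝ := ∑ i, ‖x i‖ ^ 2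

theorem nsq_eq {ι : Type*} [Fintype ι] (x : ι → ℂ) : (nsq x : ℂ) = star x ⬝ᵥ x := by
  simp [nsq, dotProduct, ← Complex.conj_mul']

theorem nsq_nonneg {ι : Type*} [Fintype ι] (x : ι → ℂ) : 0 ≤ nsq x :=
  Finset.sum_nonneg fun _ _ => by positivity

theorem nsq_mulVec {ι κ : Type*} [Fintype ι] [Fintype κ] (M : Matrix ι κ ℂ) (x : κ → ℂ) :
    (nsq (M *ᵥ x) : ℂ) = star x ⬝ᵥ ((Mᴴ * M) *ᵥ x) := by
  rw [nsq_eq, star_mulVec, ← dotProduct_mulVec, mulVec_mulVec]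

theorem nsq_isometry {ι κ : Type*} [Fintype ι] [Fintype κ] [DecidableEq κ] {V : Matrix ι κ ℂ}
    (hV : Vᴴ * V = 1) (x : κ → ℂ) : nsq (V *ᵥ x) = nsq x := by
  have := nsq_mulVec V x
  rw [hV, one_mulVec, ← nsq_eq] at this
  exact_mod_cast this

/-- The adjoint of an isometry does not increase lengths. -/
theorem nsq_coisometry_le {ι κ : Type*} [Fintype ι] [Fintype κ] [DecidableEq κ]
    {V : Matrix ι κ ℂ} (hV : Vᴴ * V = 1) (x : ι → ℂ) : nsq (Vᴴ *ᵥ x) ≤ nsq x := by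
  -- Pythagoras for the orthogonal projection `V * Vᴴ`.
  have h : nsq (x - V *ᵥ (Vᴴ *ᵥ x)) = nsq x - nsq (Vᴴ *ᵥ x) := by
    have h1 : (nsq (Vᴴ *ᵥ x) : ℂ) = star x ⬝ᵥ (V *ᵥ (Vᴴ *ᵥ x)) := by
      rw [nsq_mulVec, conjTranspose_conjTranspose, mulVec_mulVec]
    have h2 : (nsq (Vᴴ *ᵥ x) : ℂ) = star (V *ᵥ (Vᴴ *ᵥ x)) ⬝ᵥ x := by
      rw [star_mulVec, star_mulVec, conjTranspose_conjTranspose, ← dotProduct_mulVec,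
        ← dotProduct_mulVec, ← h1]
    have h3 : (nsq (Vᴴ *ᵥ x) : ℂ) = star (V *ᵥ (Vᴴ *ᵥ x)) ⬝ᵥ (V *ᵥ (Vᴴ *ᵥ x)) := by
      rw [← nsq_eq, nsq_isometry hV]
    have : ((nsq (x - V *ᵥ (Vᴴ *ᵥ x)) : ℝ) : ℂ) = ((nsq x - nsq (Vᴴ *ᵥ x) : ℝ) : ℂ) := by
      rw [nsq_eq, star_sub, sub_dotProduct, dotProduct_sub, dotProduct_sub, ← h1, ← h2, ← h3,
        ← nsq_eq]
      push_cast
      ring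
    exact_mod_cast this
  linarith [nsq_nonneg (x - V *ᵥ (Vᴴ *ᵥ x))]

theorem nsq_diagonalized {V : Matrix (Fin n) (Fin n) ℂ} {M : Matrix (Fin n) (Fin n) ℂ}
    {s : Fin n → ℝ} (h : Vᴴ * (Mᴴ * M) * V = diagonal fun i => ((s i ^ 2 : ℝ) : ℂ))
    (x : Fin n → ℂ) : nsq (M *ᵥ (V *ᵥ x)) = ∑ i, s i ^ 2 * ‖x i‖ ^ 2 := by
  have h1 : (nsq (M *ᵥ (V *ᵥ x)) : ℂ) = ((∑ i, s i ^ 2 * ‖x i‖ ^ 2 : ℝ) : ℂ) := by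
    rw [mulVec_mulVec, nsq_mulVec, conjTranspose_mul]
    rw [show Vᴴ * Mᴴ * (M * V) = Vᴴ * (Mᴴ * M) * V by simp only [Matrix.mul_assoc], h]
    simp only [dotProduct, mulVec_diagonal, Pi.star_apply]
    push_cast
    refine Finset.sum_congr rfl fun i _ => ?_
    rw [← Complex.conj_mul']
    simp only [RCLike.star_def]
    ring
  exact_mod_cast h1

/-- Singular values do not increase under compression: the Courant–Fischer comparison. -/
theorem singVal_le_of_compression {k : ℕ} {Q : Matrix (Fin k) (Fin k) ℂ}
    {M : Matrix (Fin n) (Fin n) ℂ} {H : Matrix (Fin n) (Fin k) ℂ} (hH : Hᴴ * H = 1)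
    (hQ : ∀ x, nsq (Q *ᵥ x) ≤ nsq (M *ᵥ (H *ᵥ x))) (hkn : k ≤ n) {j : ℕ} (hj : j < k) :
    singVal Q j ≤ singVal M j := by
  obtain ⟨V, hV, hVQ⟩ := exists_singVal_basis Q
  obtain ⟨Y, hY, hYM⟩ := exists_singVal_basis M
  have hY' : Y * Yᴴ = 1 := mul_eq_one_comm.mp hY
  let ext : (Fin (j + 1) → ℂ) →ₗ[ℂ] (Fin k → ℂ) :=
    { toFun := fun c i => if h : (i : ℕ) < j + 1 then c ⟨i, h⟩ else 0
      map_add' := by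
        intro a b
        ext i
        simp only [Pi.add_apply]
        split_ifs <;> simp
      map_smul' := by
        intro a b
        ext i
        simp only [Pi.smul_apply, RingHom.id_apply]
        split_ifs <;> simp }
  let coord : (Fin n → ℂ) →ₗ[ℂ] (Fin j → ℂ) :=
    LinearMap.funLeft ℂ ℂ (Fin.castLE (hj.le.trans hkn))
  -- A kernel vector is a combination of the top `j + 1` right singular vectors of `Q` whose image
  -- under `H` is orthogonal to the top `j` of `M`. Counting dimensions, a nonzero one exists.
  let L : (Fin (j + 1) → ℂ) →ₗ[ℂ] (Fin j → ℂ) :=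
    coord ∘ₗ (Yᴴ).mulVecLin ∘ₗ H.mulVecLin ∘ₗ V.mulVecLin ∘ₗ ext
  have hL : L.ker ≠ ⊥ := LinearMap.ker_ne_bot_of_finrank_lt (by simp)
  obtain ⟨c, hc, hc0⟩ := Submodule.exists_mem_ne_zero_of_ne_bot hL
  set x := ext c with hx
  set y := Yᴴ *ᵥ (H *ᵥ (V *ᵥ x)) with hy
  have hyz : ∀ i : Fin n, (i : ℕ) < j → y i = 0 := by
    intro i hi
    have := congrFun (LinearMap.mem_ker.mp hc) ⟨i, hi⟩
    simp only [L, coord, LinearMap.comp_apply, mulVecLin_apply, LinearMap.funLeft_apply] at this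
    exact this
  have hxz : ∀ i : Fin k, j < (i : ℕ) → x i = 0 := by
    intro i hi
    simp only [hx, ext, LinearMap.coe_mk, AddHom.coe_mk]
    rw [dif_neg (by omega)]
  have hYy : Y *ᵥ y = H *ᵥ (V *ᵥ x) := by
    rw [hy, mulVec_mulVec, hY', one_mulVec]
  have hny : nsq y = nsq x := by
    rw [← nsq_isometry hY, hYy, nsq_isometry hH, nsq_isometry hV]
  have h1 : singVal Q j ^ 2 * nsq x ≤ nsq (Q *ᵥ (V *ᵥ x)) := by
    rw [nsq_diagonalized hVQ, nsq, Finset.mul_sum]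
    refine Finset.sum_le_sum fun i _ => ?_
    rcases lt_or_ge j (i : ℕ) with h | h
    · simp [hxz i h]
    · have h2 := singVal_antitone Q h
      have h3 := singVal_nonneg Q j
      gcongr
  have h2 : nsq (M *ᵥ (Y *ᵥ y)) ≤ singVal M j ^ 2 * nsq y := by
    rw [nsq_diagonalized hYM, nsq, Finset.mul_sum]
    refine Finset.sum_le_sum fun i _ => ?_
    rcases lt_or_ge (i : ℕ) j with h | h
    · simp [hyz i h]
    · have h2 := singVal_antitone M h
      have h3 := singVal_nonneg M i
      gcongr
  have hpos : 0 < nsq x := by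
    obtain ⟨i, hi⟩ := Function.ne_iff.mp hc0
    have hi' : x ⟨i, by omega⟩ = c i := dif_pos i.2
    refine Finset.sum_pos' (fun _ _ => by positivity) ⟨⟨i, by omega⟩, Finset.mem_univ _, ?_⟩
    rw [hi']
    have : 0 < ‖c i‖ := norm_pos_iff.mpr hi
    positivity
  have h3 : singVal Q j ^ 2 * nsq x ≤ singVal M j ^ 2 * nsq x := by
    calc _ ≤ _ := h1
      _ ≤ _ := hQ _
      _ ≤ _ := by rw [← hYy, ← hny]; exact h2
  exact (sq_le_sq₀ (singVal_nonneg _ _) (singVal_nonneg _ _)).mp (le_of_mul_le_mul_right h3 hpos)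

/-! ### Products of singular values as extremal determinants -/

/-- The product of the `k` largest singular values. -/
noncomputable def topProd (M : Matrix (Fin n) (Fin n) ℂ) (k : ℕ) : ℝ :=
  ∏ j ∈ Finset.range k, singVal M j

theorem topProd_nonneg (M : Matrix (Fin n) (Fin n) ℂ) (k : ℕ) : 0 ≤ topProd M k :=
  Finset.prod_nonneg fun _ _ => singVal_nonneg M _

theorem norm_det_eq_topProd (M : Matrix (Fin n) (Fin n) ℂ) : ‖M.det‖ = topProd M n := by
  obtain ⟨V, hV, hVM⟩ := exists_singVal_basis M
  have h1 := congrArg Matrix.det hVM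
  rw [det_mul, det_mul, det_mul, det_diagonal, det_conjTranspose, det_conjTranspose] at h1
  have h2 := congrArg Matrix.det hV
  rw [det_mul, det_conjTranspose, det_one] at h2
  have h3 : star M.det * M.det = ∏ i : Fin n, ((singVal M i ^ 2 : ℝ) : ℂ) := by
    rw [← h1]
    linear_combination (star M.det * M.det) * (-h2)
  have h4 : ‖M.det‖ ^ 2 = topProd M n ^ 2 := by
    have : ((‖M.det‖ ^ 2 : ℝ) : ℂ) = ((topProd M n ^ 2 : ℝ) : ℂ) := by
      rw [topProd, ← Finset.prod_pow, ← Fin.prod_univ_eq_prod_range (fun j => singVal M j ^ 2) n]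
      push_cast
      rw [← Complex.conj_mul']
      simpa using h3
    exact_mod_cast this
  exact (sq_eq_sq₀ (norm_nonneg _) (topProd_nonneg _ _)).mp h4

theorem isometry_card_le {k : ℕ} {W : Matrix (Fin n) (Fin k) ℂ} (hW : Wᴴ * W = 1) : k ≤ n := by
  have h1 := Matrix.rank_mul_le_right Wᴴ W
  rw [hW, rank_one] at h1
  simpa using h1.trans (rank_le_height W)

/-- Compression lowers each singular value separately. Together with the attainment below, this
exhibits `topProd` as a maximum of determinants that depend polynomially on the pencil parameter. -/
theorem norm_det_compression_le (M : Matrix (Fin n) (Fin n) ℂ) {k : ℕ}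
    {W U : Matrix (Fin n) (Fin k) ℂ} (hW : Wᴴ * W = 1) (hU : Uᴴ * U = 1) :
    ‖(Wᴴ * M * U).det‖ ≤ topProd M k := by
  rw [norm_det_eq_topProd]
  refine Finset.prod_le_prod (fun _ _ => singVal_nonneg _ _) fun j hj => ?_
  refine singVal_le_of_compression hU (fun x => ?_) (isometry_card_le hW) (Finset.mem_range.mp hj)
  rw [← mulVec_mulVec, ← mulVec_mulVec]
  exact nsq_coisometry_le hW _

/-- The maximum is attained with the top right singular vectors as `U` and their normalised images
as `W`. If one of the singular values is `0`, no normalisation is possible, but then both sides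
vanish. -/
theorem exists_det_compression_eq (M : Matrix (Fin n) (Fin n) ℂ) {k : ℕ} (hk : k ≤ n) :
    ∃ W U : Matrix (Fin n) (Fin k) ℂ, Wᴴ * W = 1 ∧ Uᴴ * U = 1 ∧
      topProd M k = ‖(Wᴴ * M * U).det‖ := by
  obtain ⟨V, hV, hVM⟩ := exists_singVal_basis M
  let c : Fin k → Fin n := Fin.castLE hk
  have hc : Function.Injective c := Fin.castLE_injective hk
  let U : Matrix (Fin n) (Fin k) ℂ := V.submatrix id c
  have hU : Uᴴ * U = 1 := by
    ext i j
    have := congrFun (congrFun hV (c i)) (c j)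
    simpa [U, Matrix.mul_apply, one_apply, hc.eq_iff] using this
  have hUM : Uᴴ * (Mᴴ * M) * U = diagonal fun i : Fin k => ((singVal M i ^ 2 : ℝ) : ℂ) := by
    ext i j
    have := congrFun (congrFun hVM (c i)) (c j)
    simpa [U, Matrix.mul_apply, diagonal_apply, hc.eq_iff, c] using this
  by_cases h0 : ∃ j ∈ Finset.range k, singVal M j = 0
  · refine ⟨U, U, hU, hU, le_antisymm ?_ (norm_det_compression_le M hU hU)⟩
    rw [topProd, Finset.prod_eq_zero_iff.mpr h0]
    positivity
  · push Not at h0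
    have h0' : ∀ i : Fin k, (singVal M i : ℂ) ≠ 0 := fun i =>
      Complex.ofReal_ne_zero.mpr (h0 i (Finset.mem_range.mpr i.2))
    let D : Matrix (Fin k) (Fin k) ℂ := diagonal fun i => ((singVal M i)⁻¹ : ℂ)
    have hD : Dᴴ = D := by
      simp [D, diagonal_conjTranspose, Pi.star_def]
    have hWM : (M * U * D)ᴴ * M * U = diagonal fun i : Fin k => (singVal M i : ℂ) := by
      rw [conjTranspose_mul, conjTranspose_mul, hD]
      rw [show D * (Uᴴ * Mᴴ) * M * U = D * (Uᴴ * (Mᴴ * M) * U) by simp only [Matrix.mul_assoc],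
        hUM, diagonal_mul_diagonal]
      congr 1
      funext i
      have := h0' i
      push_cast
      field_simp
    refine ⟨M * U * D, U, ?_, hU, ?_⟩
    · rw [← Matrix.mul_assoc, ← Matrix.mul_assoc, hWM, diagonal_mul_diagonal, ← diagonal_one]
      congr 1
      funext i
      exact mul_inv_cancel₀ (h0' i)
    · rw [hWM, det_diagonal, norm_prod, topProd, ← Fin.prod_univ_eq_prod_range]
      refine Finset.prod_congr rfl fun i _ => ?_
      simp [abs_of_nonneg (singVal_nonneg M _)]

/-! ### Leading terms of compact families of polynomials -/

open Polynomial in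
theorem continuous_coeff_prod {Y ι : Type*} [TopologicalSpace Y] (s : Finset ι) (f : ι → Y → ℂ[X])
    (hf : ∀ i m, Continuous fun y => (f i y).coeff m) (m : ℕ) :
    Continuous fun y => (∏ i ∈ s, f i y).coeff m := by
  classical
  induction s using Finset.induction_on generalizing m with
  | empty => simpa using continuous_const
  | insert a s ha ih =>
    simp_rw [Finset.prod_insert ha, coeff_mul]
    exact continuous_finsetSum _ fun x _ => (hf a x.1).mul (ih x.2)

open Polynomial in
theorem continuous_coeff_det {Y : Type*} [TopologicalSpace Y] {k : ℕ}
    (M : Y → Matrix (Fin k) (Fin k) ℂ[X]) (hM : ∀ i j m, Continuous fun y => (M y i j).coeff m)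
    (m : ℕ) : Continuous fun y => (M y).det.coeff m := by
  simp_rw [det_apply, finsetSum_coeff, coeff_smul]
  exact continuous_finsetSum _ fun σ _ =>
    (continuous_coeff_prod Finset.univ (fun i y => M y (σ i) i) (fun i m => hM _ _ m) m).const_smul _

theorem isCompact_isometries (n k : ℕ) :
    IsCompact {W : Matrix (Fin n) (Fin k) ℂ | Wᴴ * W = 1} := by
  have hK : IsCompact (Set.univ.pi fun _ : Fin n => Set.univ.pi fun _ : Fin k =>
      Metric.closedBall (0 : ℂ) 1) :=
    isCompact_univ_pi fun _ => isCompact_univ_pi fun _ => isCompact_closedBall 0 1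
  refine IsCompact.of_isClosed_subset hK ?_ ?_
  · exact isClosed_eq (by fun_prop) continuous_const
  · intro W hW i _ j _
    have h1 : (∑ i, ‖W i j‖ ^ 2 : ℝ) = 1 := by
      have := congrFun (congrFun hW j) j
      simp only [Matrix.mul_apply, conjTranspose_apply, one_apply_eq, RCLike.star_def,
        Complex.conj_mul'] at this
      exact_mod_cast this
    have h2 : ‖W i j‖ ^ 2 ≤ 1 := h1 ▸ Finset.single_le_sum (f := fun i => ‖W i j‖ ^ 2)
      (fun _ _ => by positivity) (Finset.mem_univ i)
    simpa using (sq_le_one_iff₀ (norm_nonneg _)).mp h2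

open Polynomial in
/-- The leading behaviour at `0` of the supremum of the moduli of a compact family of
polynomials. -/
theorem exists_leading_term {Y : Type*} [TopologicalSpace Y] [CompactSpace Y] (p : Y → ℂ[X])
    (hp : ∀ i, Continuous fun y => (p y).coeff i) (N : ℕ) (hN : ∀ y, (p y).natDegree ≤ N)
    (S : ℂ → ℝ) (hle : ∀ y z, ‖(p y).eval z‖ ≤ S z) (hex : ∀ z, ∃ y, S z = ‖(p y).eval z‖) :
    (∀ z, S z = 0) ∨ ∃ (d : ℕ) (P : ℂ[X]), P.eval 0 ≠ 0 ∧
      (∀ z, ‖z‖ ^ d * ‖P.eval z‖ ≤ S z) ∧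
      ∃ C : ℝ, 0 ≤ C ∧ ∀ z, ‖z‖ ≤ 1 → S z ≤ ‖z‖ ^ d * (‖P.eval 0‖ + C * ‖z‖) := by
  by_cases h0 : ∀ i y, (p y).coeff i = 0
  · left
    intro z
    obtain ⟨y, hy⟩ := hex z
    rw [hy, show p y = 0 from Polynomial.ext fun i => by simp [h0 i y]]
    simp
  right
  push Not at h0
  classical
  -- The least order at which some member of the family has a nonzero coefficient.
  let d := Nat.find h0
  obtain ⟨y₀, hy₀⟩ : ∃ y, (p y).coeff d ≠ 0 := Nat.find_spec h0
  have hd : ∀ y i, i < d → (p y).coeff i = 0 := fun y i hi => by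
    have := Nat.find_min h0 hi
    push Not at this
    exact this y
  have hdvd : ∀ y, ∃ Q : ℂ[X], p y = X ^ d * Q := fun y =>
    X_pow_dvd_iff.mpr (hd y)
  choose Q hQ using hdvd
  have hQc : ∀ y i, (Q y).coeff i = (p y).coeff (i + d) := fun y i => by
    rw [hQ y, coeff_X_pow_mul]
  have hQN : ∀ y, (Q y).natDegree ≤ N := fun y => by
    rw [natDegree_le_iff_coeff_eq_zero]
    intro m hm
    rw [hQc]
    exact coeff_eq_zero_of_natDegree_lt ((hN y).trans_lt (by omega))
  have hbdd : ∀ i, ∃ K, ∀ y, ‖(p y).coeff i‖ ≤ K := fun i => by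
    obtain ⟨K, hK⟩ := (isCompact_range (hp i)).isBounded.exists_norm_le
    exact ⟨K, fun y => hK _ ⟨y, rfl⟩⟩
  choose K hK using hbdd
  have hKn : ∀ i, 0 ≤ K i := fun i => (norm_nonneg _).trans (hK i y₀)
  -- The member with the largest coefficient of order `d`. Divided by `X ^ d`, it serves as `P`: it
  -- bounds `S` from below everywhere, and its value at `0` dominates the leading coefficient of
  -- every other member.
  obtain ⟨y₁, -, hy₁⟩ := isCompact_univ.exists_isMaxOn ⟨y₀, Set.mem_univ _⟩
    (hp d).norm.continuousOn
  have hy₁' : ∀ y, ‖(p y).coeff d‖ ≤ ‖(p y₁).coeff d‖ := fun y => hy₁ (Set.mem_univ y)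
  have hQ0 : ∀ y, (Q y).eval 0 = (p y).coeff d := fun y => by
    rw [← coeff_zero_eq_eval_zero, hQc, zero_add]
  refine ⟨d, Q y₁, ?_, ?_, ∑ i ∈ Finset.range N, K (i + 1 + d),
    Finset.sum_nonneg fun _ _ => hKn _, ?_⟩
  · rw [hQ0, ← norm_pos_iff]
    exact (norm_pos_iff.mpr hy₀).trans_le (hy₁' y₀)
  · intro z
    have := hle y₁ z
    rwa [hQ y₁, eval_mul, eval_pow, eval_X, norm_mul, norm_pow] at this
  · intro z hz
    obtain ⟨y, hy⟩ := hex z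
    rw [hy, hQ y, eval_mul, eval_pow, eval_X, norm_mul, norm_pow]
    gcongr
    rw [eval_eq_sum_range' (Nat.lt_succ_of_le (hQN y)), Finset.sum_range_succ', hQ0, pow_zero,
      mul_one, Finset.sum_mul, add_comm]
    refine (norm_add_le _ _).trans (add_le_add (by simpa [hQc] using hy₁' y) ?_)
    refine (norm_sum_le _ _).trans (Finset.sum_le_sum fun i _ => ?_)
    rw [norm_mul, norm_pow, hQc]
    have h1 : ‖z‖ ^ (i + 1) ≤ ‖z‖ := by
      rw [pow_succ]
      exact mul_le_of_le_one_left (norm_nonneg _) (pow_le_one₀ (norm_nonneg _) hz)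
    exact mul_le_mul (hK _ _) h1 (by positivity) (hKn _)

-- The compact family is indexed by the pairs of isometries; each compressed determinant is a
-- polynomial in `z` of degree at most `k`.
open Polynomial in
theorem topProd_pencil_leading_term {n : ℕ} (A B : Matrix (Fin n) (Fin n) ℂ) (k : ℕ) (hk : k ≤ n) :
    (∀ z : ℂ, topProd (A + z • B) k = 0) ∨ ∃ (d : ℕ) (P : ℂ[X]), P.eval 0 ≠ 0 ∧
      (∀ z : ℂ, ‖z‖ ^ d * ‖P.eval z‖ ≤ topProd (A + z • B) k) ∧
      ∃ C : ℝ, 0 ≤ C ∧ ∀ z : ℂ, ‖z‖ ≤ 1 →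
        topProd (A + z • B) k ≤ ‖z‖ ^ d * (‖P.eval 0‖ + C * ‖z‖) := by
  let I := {W : Matrix (Fin n) (Fin k) ℂ | Wᴴ * W = 1}
  have : CompactSpace I := isCompact_iff_compactSpace.mp (isCompact_isometries n k)
  let p : I × I → ℂ[X] := fun y =>
    ((X : ℂ[X]) • (y.1.1ᴴ * B * y.2.1).map C + (y.1.1ᴴ * A * y.2.1).map C).det
  have hp : ∀ y z, (p y).eval z = (y.1.1ᴴ * (A + z • B) * y.2.1).det := by
    intro y z
    simp only [p]
    rw [← coe_evalRingHom, RingHom.map_det]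
    congr 1
    ext i j
    have h1 : ∀ M : Matrix (Fin k) (Fin k) ℂ, (M.map C) i j = C (M i j) := fun _ => rfl
    rw [Matrix.mul_add, Matrix.add_mul, Matrix.mul_smul, Matrix.smul_mul]
    simp only [RingHom.mapMatrix_apply, map_apply, Matrix.add_apply, Matrix.smul_apply,
      coe_evalRingHom, smul_eq_mul, eval_add, eval_mul, eval_X, eval_C]
    ring
  refine exists_leading_term p ?_ k ?_ _ ?_ ?_
  · refine continuous_coeff_det _ fun i j m => ?_
    have h1 : ∀ M : Matrix (Fin n) (Fin n) ℂ,
        Continuous fun y : I × I => (y.1.1ᴴ * M * y.2.1) i j := by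
      intro M
      have : Continuous fun y : I × I => y.1.1ᴴ * M * y.2.1 := by fun_prop
      exact this.matrix_elem i j
    have h2 : ∀ y : I × I, (((X : ℂ[X]) • (y.1.1ᴴ * B * y.2.1).map C +
        (y.1.1ᴴ * A * y.2.1).map C) i j).coeff m = (X : ℂ[X]).coeff m * (y.1.1ᴴ * B * y.2.1) i j +
        if m = 0 then (y.1.1ᴴ * A * y.2.1) i j else 0 := by
      intro y
      have h1 : ∀ M : Matrix (Fin k) (Fin k) ℂ, (M.map C) i j = C (M i j) := fun _ => rfl
      rw [Matrix.add_apply, Matrix.smul_apply, h1, h1, smul_eq_mul, coeff_add, coeff_mul_C, coeff_C]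
    simp_rw [h2]
    refine ((h1 B).const_mul _).add ?_
    split_ifs
    · exact h1 A
    · exact continuous_const
  · intro y
    simpa only [Fintype.card_fin] using natDegree_det_X_add_C_le (y.1.1ᴴ * B * y.2.1) (y.1.1ᴴ * A * y.2.1)
  · intro y z
    rw [hp]
    exact norm_det_compression_le _ y.1.2 y.2.2
  · intro z
    obtain ⟨W, U, hW, hU, h⟩ := exists_det_compression_eq (A + z • B) hk
    exact ⟨(⟨W, hW⟩, ⟨U, hU⟩), by rw [hp, h]⟩

/-! ### Mean values on circles and elementary inequalities -/

open Polynomial in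
/-- A linear combination of the functions `log ‖P k ·‖` attains at least its central value on every
circle that encloses no zero. -/
theorem exists_sum_log_norm_eval_nonneg (m : ℕ) (P : ℕ → ℂ[X]) (α : ℕ → ℝ) {t : ℝ} (ht : 0 < t)
    (hP : ∀ k < m, ∀ z : ℂ, ‖z‖ ≤ t → (P k).eval z ≠ 0) :
    ∃ z : ℂ, ‖z‖ = t ∧
      0 ≤ ∑ k ∈ Finset.range m, α k * (Real.log ‖(P k).eval z‖ - Real.log ‖(P k).eval 0‖) := by
  set g : ℂ → ℝ := fun z =>
    ∑ k ∈ Finset.range m, α k * (Real.log ‖(P k).eval z‖ - Real.log ‖(P k).eval 0‖) with hg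
  have hlog : ∀ k < m, ContinuousOn (fun z => Real.log ‖(P k).eval z‖) (Metric.sphere 0 t) := by
    intro k hk
    refine ContinuousOn.log (by fun_prop) fun z hz => ?_
    exact norm_ne_zero_iff.mpr (hP k hk z (by simpa using (mem_sphere_zero_iff_norm.mp hz).le))
  have hk : ∀ k ∈ Finset.range m, ContinuousOn
      (fun z => α k * (Real.log ‖(P k).eval z‖ - Real.log ‖(P k).eval 0‖)) (Metric.sphere 0 t) :=
    fun k hk => ((hlog k (Finset.mem_range.mp hk)).sub continuousOn_const).const_smul (α k)
  have hgc : ContinuousOn g (Metric.sphere 0 t) := continuousOn_finsetSum _ hk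
  obtain ⟨z, hz, hmax⟩ := (isCompact_sphere (0 : ℂ) t).exists_isMaxOn
    (NormedSpace.sphere_nonempty.mpr ht.le) hgc
  refine ⟨z, mem_sphere_zero_iff_norm.mp hz, ?_⟩
  -- Each `log ‖P k‖` is harmonic near the closed disc, so its circle average is its central value.
  -- The signs of the `α k` are irrelevant, and the maximum of `g` is at least its average.
  have havg : Real.circleAverage g 0 t = 0 := by
    rw [hg, Real.circleAverage_fun_sum fun k hk' => (hk k hk').circleIntegrable ht.le]
    refine Finset.sum_eq_zero fun k hk' => ?_
    have hk'' := Finset.mem_range.mp hk'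
    have h1 : Real.circleAverage (fun z => Real.log ‖(P k).eval z‖) 0 t =
        Real.log ‖(P k).eval 0‖ := by
      refine AnalyticOnNhd.circleAverage_log_norm_of_ne_zero (g := fun z => (P k).eval z) ?_ ?_
      · intro z _
        exact (P k).differentiable.analyticAt z
      · intro z hz
        rw [abs_of_pos ht] at hz
        exact hP k hk'' z (by simpa using hz)
    have h2 := Real.circleAverage_fun_sub ((hlog k hk'').circleIntegrable ht.le)
      (continuousOn_const (c := Real.log ‖(P k).eval 0‖) |>.circleIntegrable ht.le)
    rw [h1, Real.circleAverage_const, sub_self] at h2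
    have h3 := Real.circleAverage_fun_smul (a := α k) (c := (0 : ℂ)) (R := t)
      (f := fun z => Real.log ‖(P k).eval z‖ - Real.log ‖(P k).eval 0‖)
    rw [h2, smul_zero] at h3
    exact h3
  rw [← havg]
  refine Real.circleAverage_mono_on_of_le_circle (hgc.circleIntegrable ht.le) fun x hx => ?_
  rw [abs_of_pos ht] at hx
  exact hmax hx

theorem sum_mul_sub_eq_abel (w l : ℕ → ℝ) (m : ℕ) :
    ∑ k ∈ Finset.range m, w k * (l (k + 1) - l k) =
      ∑ k ∈ Finset.range m, (w k - w (k + 1)) * l (k + 1) + w m * l m - w 0 * l 0 := by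
  induction m with
  | zero => simp
  | succ m ih =>
    rw [Finset.sum_range_succ, Finset.sum_range_succ, ih]
    ring

/-- As a function of `log x`, the power `x ^ p` is convex, so it lies above its tangent at `log τ`.
-/
theorem rpow_tangent_le {x τ p : ℝ} (hx : 0 < x) (hτ : 0 < τ) :
    τ ^ p * (1 + p * (Real.log x - Real.log τ)) ≤ x ^ p := by
  have h1 := Real.add_one_le_exp (p * (Real.log x - Real.log τ))
  have h2 : x ^ p = τ ^ p * Real.exp (p * (Real.log x - Real.log τ)) := by
    rw [Real.rpow_def_of_pos hx, Real.rpow_def_of_pos hτ, ← Real.exp_add]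
    ring_nf
  rw [h2]
  have := Real.rpow_pos_of_pos hτ p
  nlinarith

/-- A monomial bounded by a function tending to `1` is eventually at most `1`. -/
theorem eventually_monomial_le_one {κ : ℝ} (hκ : 0 < κ) (m : ℤ) {u : ℝ → ℝ}
    (hu : Tendsto u (𝓝[>] 0) (𝓝 1)) (hle : ∀ᶠ t in 𝓝[>] 0, κ * t ^ m ≤ u t) :
    ∀ᶠ t in 𝓝[>] (0 : ℝ), κ * t ^ m ≤ 1 := by
  have hpos : ∀ᶠ t in 𝓝[>] (0 : ℝ), 0 < t := eventually_mem_nhdsWithin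
  rcases lt_trichotomy m 0 with hm | rfl | hm
  · exfalso
    have hev : ∀ᶠ t in 𝓝[>] (0 : ℝ), κ ≤ u t * t := by
      have h1 : ∀ᶠ t in 𝓝[>] (0 : ℝ), t < 1 :=
        eventually_nhdsWithin_of_eventually_nhds (eventually_lt_nhds one_pos)
      filter_upwards [hle, hpos, h1] with t h2 h3 h4
      have h5 : t⁻¹ ≤ t ^ m := by
        rw [← _root_.zpow_neg_one]
        exact zpow_le_zpow_right_of_le_one₀ h3 h4.le (by omega)
      have h6 : κ * t⁻¹ ≤ u t := (mul_le_mul_of_nonneg_left h5 hκ.le).trans h2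
      calc κ = κ * t⁻¹ * t := by field_simp
        _ ≤ _ := by gcongr
    have hlim : Tendsto (fun t => u t * t) (𝓝[>] 0) (𝓝 (1 * 0)) :=
      hu.mul (tendsto_id.mono_left nhdsWithin_le_nhds)
    have := ge_of_tendsto hlim hev
    linarith
  · simp only [zpow_zero, mul_one] at hle ⊢
    exact Eventually.of_forall fun _ => ge_of_tendsto hu hle
  · obtain ⟨k, rfl⟩ := Int.eq_ofNat_of_zero_le hm.le
    have hk : k ≠ 0 := by omega
    have hlim : Tendsto (fun t : ℝ => κ * t ^ k) (𝓝[>] 0) (𝓝 (κ * 0 ^ k)) :=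
      ((tendsto_id.mono_left nhdsWithin_le_nhds).pow k).const_mul κ
    rw [zero_pow hk, mul_zero] at hlim
    filter_upwards [hlim.eventually (eventually_le_nhds one_pos)] with t ht
    simpa using ht

/-! ### Leading monomials of the singular values of a pencil -/

/-- Leading monomials `c k * ‖z‖ ^ e k` of the singular values of the pencil `A + z • B` as
`z → 0`. -/
structure PencilExpansion {n : ℕ} (A B : Matrix (Fin n) (Fin n) ℂ) where
  /-- The generic rank of the pencil. -/
  genericRank : ℕ
  /-- The rank at `0`. -/
  baseRank : ℕ
  /-- The leading coefficients. -/
  c : ℕ → ℝ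
  /-- The leading exponents. -/
  e : ℕ → ℤ
  base_le : baseRank ≤ genericRank
  generic_le : genericRank ≤ n
  c_pos : ∀ k < genericRank, 0 < c k
  e_eq_zero : ∀ k < baseRank, e k = 0
  c_eq : ∀ k < baseRank, c k = singVal A k
  singVal_eq_zero : ∀ k, baseRank ≤ k → k < n → singVal A k = 0
  vanish : ∀ k, genericRank ≤ k → k < n → ∀ᶠ z in 𝓝[≠] (0 : ℂ), singVal (A + z • B) k = 0
  tendsto : ∀ k < genericRank,
    Tendsto (fun z : ℂ => singVal (A + z • B) k / (c k * ‖z‖ ^ e k)) (𝓝[≠] 0) (𝓝 1)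
  lower : ∀ p : ℝ, 0 < p → ∀ᶠ t in 𝓝[>] (0 : ℝ), ∃ z : ℂ, ‖z‖ = t ∧
    ∑ k ∈ Finset.range genericRank, (c k * t ^ e k) ^ p ≤ ∑ i : Fin n, singVal (A + z • B) i ^ p

theorem topProd_succ (M : Matrix (Fin n) (Fin n) ℂ) (k : ℕ) :
    topProd M (k + 1) = topProd M k * singVal M k := Finset.prod_range_succ _ _

theorem topProd_ne_zero_of_le {M : Matrix (Fin n) (Fin n) ℂ} {j k : ℕ} (hjk : j ≤ k)
    (h : topProd M k ≠ 0) : topProd M j ≠ 0 := by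
  rw [topProd, Finset.prod_ne_zero_iff] at h ⊢
  exact fun i hi => h i (Finset.range_mono hjk hi)

theorem tendsto_ofReal_nhdsGT : Tendsto (fun t : ℝ => (t : ℂ)) (𝓝[>] 0) (𝓝[≠] 0) := by
  refine tendsto_nhdsWithin_iff.mpr ⟨?_, ?_⟩
  · exact (Complex.continuous_ofReal.tendsto' 0 0 (by simp)).mono_left nhdsWithin_le_nhds
  · filter_upwards [self_mem_nhdsWithin] with t ht
    simpa using (ne_of_gt ht)

-- The `k`-th singular value is the quotient of consecutive products, so its monomial is the
-- quotient of theirs, with an integer exponent. The field `lower` must be exact, not merely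
-- asymptotic; it is proved by linearising `x ^ p` in `log x` and applying the mean value property
-- to the logarithms of the products.
open Polynomial in
theorem nonempty_pencilExpansion (A B : Matrix (Fin n) (Fin n) ℂ) :
    Nonempty (PencilExpansion A B) := by
  classical
  set S : ℂ → ℕ → ℝ := fun z k => topProd (A + z • B) k with hS
  set σ : ℂ → ℕ → ℝ := fun z k => singVal (A + z • B) k with hσ
  have hS0 : ∀ z, S z 0 = 1 := fun z => by simp [hS, topProd]
  let ρ := Nat.findGreatest (fun k => ∃ z, S z k ≠ 0) n
  have hρn : ρ ≤ n := Nat.findGreatest_le n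
  obtain ⟨z₀, hz₀⟩ : ∃ z, S z ρ ≠ 0 :=
    Nat.findGreatest_spec (P := fun k => ∃ z, S z k ≠ 0) (Nat.zero_le n) ⟨0, by simp [hS0]⟩
  have hρS : ∀ k, ρ < k → k ≤ n → ∀ z, S z k = 0 := fun k h1 h2 z => by
    by_contra h3
    exact Nat.findGreatest_is_greatest h1 h2 ⟨z, h3⟩
  -- At `k = 0` the product is constantly `1`; fixing `d = 0` and `P = 1` there makes the initial
  -- term of the later Abel summation vanish.
  have H : ∀ k, ∃ (d : ℕ) (P : ℂ[X]) (C : ℝ), k ≤ ρ → P.eval 0 ≠ 0 ∧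
      (∀ z : ℂ, ‖z‖ ^ d * ‖P.eval z‖ ≤ S z k) ∧ 0 ≤ C ∧
      (∀ z : ℂ, ‖z‖ ≤ 1 → S z k ≤ ‖z‖ ^ d * (‖P.eval 0‖ + C * ‖z‖)) ∧
      (k = 0 → d = 0 ∧ P = 1) := by
    intro k
    rcases Nat.eq_zero_or_pos k with rfl | hk
    · exact ⟨0, 1, 0, fun _ => by simp [hS0]⟩
    by_cases hkρ : k ≤ ρ
    · rcases topProd_pencil_leading_term A B k (hkρ.trans hρn) with h | ⟨d, P, h1, h2, C, h3, h4⟩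
      · exact absurd (h z₀) (topProd_ne_zero_of_le hkρ hz₀)
      · exact ⟨d, P, C, fun _ => ⟨h1, h2, h3, h4, fun h => absurd h hk.ne'⟩⟩
    · exact ⟨0, 0, 0, fun h => absurd h hkρ⟩
  choose d P C H using H
  have hP0 : ∀ k ≤ ρ, (P k).eval 0 ≠ 0 := fun k hk => (H k hk).1
  set γ : ℕ → ℝ := fun k => ‖(P k).eval 0‖ with hγ
  have hγ0 : ∀ k ≤ ρ, 0 < γ k := fun k hk => norm_pos_iff.mpr (hP0 k hk)
  have hlow : ∀ k ≤ ρ, ∀ z : ℂ, ‖z‖ ^ d k * ‖(P k).eval z‖ ≤ S z k := fun k hk => (H k hk).2.1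
  have hd0 : d 0 = 0 := ((H 0 (Nat.zero_le _)).2.2.2.2 rfl).1
  have hP1 : P 0 = 1 := ((H 0 (Nat.zero_le _)).2.2.2.2 rfl).2
  have hne : ∀ᶠ z in 𝓝[≠] (0 : ℂ), z ≠ 0 := eventually_mem_nhdsWithin
  have hle1 : ∀ᶠ z in 𝓝[≠] (0 : ℂ), ‖z‖ ≤ 1 := by
    filter_upwards [nhdsWithin_le_nhds (Metric.closedBall_mem_nhds (0 : ℂ) one_pos)] with z hz
    simpa using hz
  -- asymptotics of the products
  have hlim : ∀ k ≤ ρ, Tendsto (fun z => S z k / (γ k * ‖z‖ ^ d k)) (𝓝[≠] 0) (𝓝 1) := by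
    intro k hk
    have hγk := hγ0 k hk
    have h1 : Tendsto (fun z => ‖(P k).eval z‖ / γ k) (𝓝[≠] 0) (𝓝 1) := by
      have h2 : Tendsto (fun z => ‖(P k).eval z‖ / γ k) (𝓝 0) (𝓝 (γ k / γ k)) :=
        (((P k).continuous.norm).tendsto 0).div_const _
      rw [div_self hγk.ne'] at h2
      exact h2.mono_left nhdsWithin_le_nhds
    have h3 : Tendsto (fun z : ℂ => (γ k + C k * ‖z‖) / γ k) (𝓝[≠] 0) (𝓝 1) := by
      have h2 : Tendsto (fun z : ℂ => (γ k + C k * ‖z‖) / γ k) (𝓝 0)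
          (𝓝 ((γ k + C k * ‖(0 : ℂ)‖) / γ k)) :=
        (((continuous_norm.tendsto (0 : ℂ)).const_mul (C k)).const_add (γ k)).div_const _
      rw [norm_zero, mul_zero, add_zero, div_self hγk.ne'] at h2
      exact h2.mono_left nhdsWithin_le_nhds
    refine tendsto_of_tendsto_of_tendsto_of_le_of_le' h1 h3 ?_ ?_
    · filter_upwards [hne] with z hz
      have hz' : 0 < ‖z‖ := norm_pos_iff.mpr hz
      rw [div_le_div_iff₀ hγk (by positivity)]
      have := mul_le_mul_of_nonneg_right (hlow k hk z) hγk.le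
      linarith
    · filter_upwards [hne, hle1] with z hz hz1
      have hz' : 0 < ‖z‖ := norm_pos_iff.mpr hz
      rw [div_le_div_iff₀ (by positivity) hγk]
      have := mul_le_mul_of_nonneg_right ((H k hk).2.2.2.1 z hz1) hγk.le
      linarith
  have hSpos : ∀ k ≤ ρ, ∀ᶠ z in 𝓝[≠] (0 : ℂ), 0 < S z k := by
    intro k hk
    filter_upwards [(hlim k hk).eventually (lt_mem_nhds one_pos), hne] with z hz hz0
    have hz' : 0 < ‖z‖ := norm_pos_iff.mpr hz0
    exact (div_pos_iff_of_pos_right (mul_pos (hγ0 k hk) (by positivity))).mp hz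
  set c : ℕ → ℝ := fun k => γ (k + 1) / γ k with hc
  set e : ℕ → ℤ := fun k => (d (k + 1) : ℤ) - d k with he
  have hcpos : ∀ k < ρ, 0 < c k := fun k hk => div_pos (hγ0 _ hk) (hγ0 _ hk.le)
  have hτ : ∀ k < ρ, ∀ x : ℝ, 0 < x →
      c k * x ^ e k = (γ (k + 1) * x ^ d (k + 1)) / (γ k * x ^ d k) := by
    intro k hk x hx
    simp only [hc, he]
    rw [zpow_sub₀ hx.ne', zpow_natCast, zpow_natCast, div_mul_div_comm]
  have htend : ∀ k < ρ, Tendsto (fun z => σ z k / (c k * ‖z‖ ^ e k)) (𝓝[≠] 0) (𝓝 1) := by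
    intro k hk
    have h1 := (hlim (k + 1) hk).div (hlim k hk.le) one_ne_zero
    rw [div_one] at h1
    refine h1.congr' ?_
    filter_upwards [hne, hSpos k hk.le] with z hz hSz
    have hz' : 0 < ‖z‖ := norm_pos_iff.mpr hz
    have h2 := hγ0 k hk.le
    have h3 := hγ0 (k + 1) hk
    rw [hτ k hk _ hz', Pi.div_apply]
    have h4 : S z (k + 1) = S z k * σ z k := topProd_succ _ _
    rw [h4]
    field_simp
  have hzero : ∀ k ≤ ρ, S 0 k ≠ 0 ↔ d k = 0 := by
    intro k hk
    constructor
    · intro h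
      by_contra hd
      have h1 := (H k hk).2.2.2.1 0 (by simp)
      rw [norm_zero, zero_pow hd, zero_mul] at h1
      exact h (le_antisymm h1 (topProd_nonneg _ _))
    · intro hd
      have h1 := hlow k hk 0
      rw [hd, pow_zero, one_mul] at h1
      exact ((hγ0 k hk).trans_le h1).ne'
  have hS0γ : ∀ k ≤ ρ, d k = 0 → S 0 k = γ k := by
    intro k hk hd
    have h1 := hlow k hk 0
    have h2 := (H k hk).2.2.2.1 0 (by simp)
    rw [hd, pow_zero, one_mul] at h1 h2
    rw [norm_zero, mul_zero, add_zero] at h2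
    exact le_antisymm h2 h1
  -- The product of `k` singular values is nonzero at `0` exactly when its order `d k` is `0`, so
  -- this is the rank of `A`.
  let r := Nat.findGreatest (fun k => d k = 0) ρ
  have hrρ : r ≤ ρ := Nat.findGreatest_le ρ
  have hdr : d r = 0 := Nat.findGreatest_spec (P := fun k => d k = 0) (Nat.zero_le ρ) hd0
  have hdk : ∀ k ≤ r, d k = 0 := fun k hk =>
    (hzero k (hk.trans hrρ)).mp (topProd_ne_zero_of_le hk ((hzero r hrρ).mpr hdr))
  have hA : ∀ k, σ 0 k = singVal A k := fun k => by simp [hσ]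
  -- The monomials must be truly ordered for small `t`, since they give the weights below. The ratio
  -- is itself a monomial bounded by a function tending to `1`.
  have hanti : ∀ k, k + 1 < ρ →
      ∀ᶠ t in 𝓝[>] (0 : ℝ), c (k + 1) * t ^ e (k + 1) ≤ c k * t ^ e k := by
    intro k hk
    have hk' : k < ρ := by omega
    have h1 := (htend k hk').comp tendsto_ofReal_nhdsGT
    have h2 := (htend (k + 1) hk).comp tendsto_ofReal_nhdsGT
    have h3 := h1.div h2 one_ne_zero
    rw [div_one] at h3
    have hκ : 0 < c (k + 1) / c k := div_pos (hcpos _ hk) (hcpos _ hk')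
    have hpos : ∀ᶠ t in 𝓝[>] (0 : ℝ), 0 < t := eventually_mem_nhdsWithin
    have hmon : ∀ t : ℝ, 0 < t → c (k + 1) / c k * t ^ (e (k + 1) - e k) =
        (c (k + 1) * t ^ e (k + 1)) / (c k * t ^ e k) := fun t ht => by
      rw [zpow_sub₀ ht.ne', div_mul_div_comm]
    filter_upwards [eventually_monomial_le_one hκ (e (k + 1) - e k) h3 (by
      filter_upwards [hpos, h2.eventually (lt_mem_nhds one_pos)] with t ht hσ'
      rw [hmon t ht, Pi.div_apply]
      simp only [Function.comp_apply, Complex.norm_real, Real.norm_eq_abs, abs_of_pos ht] at hσ' ⊢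
      have hd1 : 0 < c (k + 1) * t ^ e (k + 1) := mul_pos (hcpos _ hk) (zpow_pos ht _)
      have hd2 : 0 < c k * t ^ e k := mul_pos (hcpos _ hk') (zpow_pos ht _)
      have hs := (div_pos_iff_of_pos_right hd1).mp hσ'
      have hmono : σ t (k + 1) ≤ σ t k := singVal_antitone _ (Nat.le_succ k)
      rw [div_div_div_eq, div_le_div_iff₀ hd2 (mul_pos hd2 hs)]
      nlinarith [mul_pos hd1 hd2]), hpos] with t ht htpos
    rw [hmon t htpos] at ht
    exact (div_le_one (mul_pos (hcpos _ hk') (zpow_pos htpos _))).mp ht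
  refine ⟨⟨ρ, r, c, e, hrρ, hρn, hcpos, ?_, ?_, ?_, ?_, htend, ?_⟩⟩
  · intro k hk
    simp [he, hdk k hk.le, hdk (k + 1) hk]
  · intro k hk
    have h1 : S 0 (k + 1) = S 0 k * σ 0 k := topProd_succ _ _
    rw [hS0γ _ (by omega) (hdk (k + 1) hk), hS0γ _ (by omega) (hdk k hk.le), hA] at h1
    have h2 := hγ0 k (by omega)
    simp only [hc, h1]
    field_simp
  · have h0 : r < n → singVal A r = 0 := by
      intro hrn
      have h1 : S 0 (r + 1) = S 0 r * σ 0 r := topProd_succ _ _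
      have h2 : S 0 (r + 1) = 0 := by
        by_cases hr : r + 1 ≤ ρ
        · by_contra h
          have := Nat.le_findGreatest (P := fun k => d k = 0) hr ((hzero _ hr).mp h)
          omega
        · exact hρS _ (by omega) hrn 0
      rw [h2, hA] at h1
      exact (mul_eq_zero.mp h1.symm).resolve_left ((hzero r hrρ).mpr hdr)
    intro k hk hkn
    exact le_antisymm ((singVal_antitone A hk).trans (h0 (by omega)).le) (singVal_nonneg _ _)
  · intro k hk hkn
    filter_upwards [hSpos ρ le_rfl] with z hz
    have h1 : S z (ρ + 1) = S z ρ * σ z ρ := topProd_succ _ _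
    rw [hρS _ (Nat.lt_succ_self ρ) (by omega)] at h1
    have h2 := (mul_eq_zero.mp h1.symm).resolve_left hz.ne'
    exact le_antisymm ((singVal_antitone _ hk).trans h2.le) (singVal_nonneg _ _)
  · intro p hp
    have hnz : ∀ᶠ t in 𝓝[>] (0 : ℝ), ∀ k ≤ ρ, ∀ z : ℂ, ‖z‖ ≤ t → (P k).eval z ≠ 0 := by
      have h1 : ∀ᶠ z in 𝓝 (0 : ℂ), ∀ k ∈ Finset.range (ρ + 1), (P k).eval z ≠ 0 :=
        (Finset.eventually_all _).mpr fun k hk =>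
          (P k).continuous.continuousAt.eventually_ne
            (hP0 k (Nat.lt_succ_iff.mp (Finset.mem_range.mp hk)))
      obtain ⟨ε, hε, h2⟩ := Metric.eventually_nhds_iff.mp h1
      filter_upwards [eventually_nhdsWithin_of_eventually_nhds (eventually_lt_nhds hε)]
        with t ht k hk z hz
      exact h2 (by simpa using hz.trans_lt ht) k (Finset.mem_range.mpr (Nat.lt_succ_of_le hk))
    have hant : ∀ᶠ t in 𝓝[>] (0 : ℝ), ∀ k ∈ Finset.range (ρ - 1),
        c (k + 1) * t ^ e (k + 1) ≤ c k * t ^ e k :=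
      (Finset.eventually_all _).mpr fun k hk => hanti k (by
        have := Finset.mem_range.mp hk
        omega)
    filter_upwards [hnz, hant, eventually_mem_nhdsWithin] with t hnz hant ht
    have ht : 0 < t := ht
    -- These are the slopes of the tangent inequality up to the factor `p`. They decrease, so Abel
    -- summation gives nonnegative coefficients, and the lower bounds on the products can be
    -- inserted. The value `0` at `ρ` kills the boundary term.
    let w : ℕ → ℝ := fun k => if k < ρ then (c k * t ^ e k) ^ p else 0
    have hτpos : ∀ k < ρ, 0 < c k * t ^ e k := fun k hk => mul_pos (hcpos k hk) (zpow_pos ht _)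
    have hw : ∀ k < ρ, 0 ≤ w k - w (k + 1) := by
      intro k hk
      simp only [w, if_pos hk]
      split_ifs with h
      · have h1 := hant k (Finset.mem_range.mpr (by omega))
        have h2 := Real.rpow_le_rpow (hτpos _ h).le h1 hp.le
        linarith
      · have := Real.rpow_nonneg (hτpos k hk).le p
        linarith
    obtain ⟨z, hzt, hz⟩ := exists_sum_log_norm_eval_nonneg ρ (fun k => P (k + 1))
      (fun k => w k - w (k + 1)) ht fun k hk => hnz (k + 1) hk
    refine ⟨z, hzt, ?_⟩
    have hSz : ∀ k ≤ ρ, 0 < S z k := fun k hk => lt_of_lt_of_le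
      (by
        have := norm_pos_iff.mpr (hnz k hk z hzt.le)
        rw [hzt]
        positivity) (hlow k hk z)
    have hσz : ∀ k < ρ, 0 < σ z k := fun k hk => by
      have h1 : S z (k + 1) = S z k * σ z k := topProd_succ _ _
      have h2 := hSz (k + 1) hk
      rw [h1] at h2
      exact (pos_iff_pos_of_mul_pos h2).mp (hSz k hk.le)
    let l : ℕ → ℝ := fun k => Real.log (S z k) - Real.log (γ k * t ^ d k)
    have hl0 : l 0 = 0 := by simp [l, hS0, hγ, hP1, hd0]
    have hlsub : ∀ k < ρ, Real.log (σ z k) - Real.log (c k * t ^ e k) = l (k + 1) - l k := by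
      intro k hk
      have h1 : S z (k + 1) = S z k * σ z k := topProd_succ _ _
      have h2 := hγ0 k hk.le
      have h3 := hγ0 (k + 1) hk
      simp only [l]
      rw [h1, hτ k hk t ht, Real.log_mul (hSz k hk.le).ne' (hσz k hk).ne',
        Real.log_div (by positivity) (by positivity)]
      ring
    have hlge : ∀ k < ρ, Real.log ‖(P (k + 1)).eval z‖ - Real.log ‖(P (k + 1)).eval 0‖ ≤
        l (k + 1) := by
      intro k hk
      have h1 := norm_pos_iff.mpr (hnz (k + 1) hk z hzt.le)
      have h2 := hlow (k + 1) hk z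
      have h3 : 0 < t ^ d (k + 1) := by positivity
      have h4 := hγ0 (k + 1) hk
      rw [hzt] at h2
      have h5 := Real.log_le_log (mul_pos h3 h1) h2
      rw [Real.log_mul h3.ne' h1.ne'] at h5
      simp only [l]
      rw [Real.log_mul h4.ne' h3.ne']
      linarith
    have hsum : 0 ≤ ∑ k ∈ Finset.range ρ, w k * (l (k + 1) - l k) := by
      rw [sum_mul_sub_eq_abel, hl0, show w ρ = 0 by simp [w]]
      rw [zero_mul, mul_zero, add_zero, sub_zero]
      refine hz.trans (Finset.sum_le_sum fun k hk => ?_)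
      have hk := Finset.mem_range.mp hk
      exact mul_le_mul_of_nonneg_left (hlge k hk) (hw k hk)
    have hmain : ∑ k ∈ Finset.range ρ, (c k * t ^ e k) ^ p +
        p * ∑ k ∈ Finset.range ρ, w k * (l (k + 1) - l k) ≤ ∑ k ∈ Finset.range ρ, σ z k ^ p := by
      rw [Finset.mul_sum, ← Finset.sum_add_distrib]
      refine Finset.sum_le_sum fun k hk => ?_
      have hk := Finset.mem_range.mp hk
      have h1 := rpow_tangent_le (p := p) (hσz k hk) (hτpos k hk)
      rw [hlsub k hk] at h1
      simp only [w, if_pos hk]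
      linarith
    have hext : ∑ k ∈ Finset.range ρ, σ z k ^ p ≤ ∑ k ∈ Finset.range n, σ z k ^ p :=
      Finset.sum_le_sum_of_subset_of_nonneg (Finset.range_mono hρn)
        fun _ _ _ => Real.rpow_nonneg (singVal_nonneg _ _) _
    rw [Fin.sum_univ_eq_sum_range (fun k => σ z k ^ p) n]
    nlinarith [mul_nonneg hp.le hsum]

/-! ### Second-order control of the large singular values -/

theorem nsq_add_add_nsq_sub {ι : Type*} [Fintype ι] (x y : ι → ℂ) :
    nsq (x + y) + nsq (x - y) = 2 * (nsq x + nsq y) := by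
  simp only [nsq, ← Finset.sum_add_distrib, Finset.mul_sum]
  refine Finset.sum_congr rfl fun i _ => ?_
  have := parallelogram_law_with_norm ℝ (x i) (y i)
  simp only [Pi.add_apply, Pi.sub_apply]
  linarith

theorem nsq_smul {ι : Type*} [Fintype ι] (z : ℂ) (x : ι → ℂ) : nsq (z • x) = ‖z‖ ^ 2 * nsq x := by
  simp [nsq, Finset.mul_sum, mul_pow]

/-- A doubly stochastic comparison: the powers of the large singular values are controlled by the
lengths of the images of an orthonormal family whose remaining members have short images. -/
theorem sum_rpow_singVal_le (M V : Matrix (Fin n) (Fin n) ℂ) (hV : Vᴴ * V = 1) (r : ℕ)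
    {s δ K ε : ℝ} (hs0 : 0 < s) (hs1 : s ≤ 1) (hδ : 0 < δ) (hε0 : 0 ≤ ε)
    (hσ : ∀ k : Fin n, (k : ℕ) < r → δ ≤ singVal M k ^ 2)
    (hK : ∀ k : Fin n, (singVal M k ^ 2) ^ s ≤ K)
    (hε : ∀ i : Fin n, r ≤ (i : ℕ) → nsq (M *ᵥ fun j => V j i) ≤ ε) :
    ∑ k : Fin n, (if (k : ℕ) < r then (singVal M k ^ 2) ^ s else 0) ≤
      ∑ i : Fin n, (if (i : ℕ) < r then nsq (M *ᵥ fun j => V j i) ^ s else 0) +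
        n * n * (K * (ε / δ)) := by
  obtain ⟨Y, hY, hYM⟩ := exists_singVal_basis M
  have hY' : Y * Yᴴ = 1 := mul_eq_one_comm.mp hY
  set G : Matrix (Fin n) (Fin n) ℂ := Yᴴ * V with hG
  have hG1 : Gᴴ * G = 1 := by
    rw [hG, conjTranspose_mul, conjTranspose_conjTranspose]
    calc _ = Vᴴ * (Y * Yᴴ) * V := by simp only [Matrix.mul_assoc]
      _ = 1 := by rw [hY', Matrix.mul_one, hV]
  have hG2 : G * Gᴴ = 1 := mul_eq_one_comm.mp hG1
  -- Squared moduli of the entries of a unitary matrix: the doubly stochastic weights expressing the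
  -- squared lengths through the squared singular values.
  set w : Fin n → Fin n → ℝ := fun i k => ‖G k i‖ ^ 2 with hw
  have hw0 : ∀ i k, 0 ≤ w i k := fun i k => by positivity
  have hrow : ∀ i, ∑ k, w i k = 1 := fun i => by
    have := congrFun (congrFun hG1 i) i
    simp only [Matrix.mul_apply, conjTranspose_apply, one_apply_eq, RCLike.star_def,
      Complex.conj_mul'] at this
    exact_mod_cast this
  have hcol : ∀ k, ∑ i, w i k = 1 := fun k => by
    have := congrFun (congrFun hG2 k) k
    simp only [Matrix.mul_apply, conjTranspose_apply, one_apply_eq, RCLike.star_def,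
      Complex.mul_conj'] at this
    exact_mod_cast this
  set x : Fin n → ℝ := fun k => singVal M k ^ 2 with hx
  have hx0 : ∀ k, 0 ≤ x k := fun k => by positivity
  have hX : ∀ i, nsq (M *ᵥ fun j => V j i) = ∑ k, w i k * x k := fun i => by
    have h1 : (fun j => V j i) = Y *ᵥ fun k => G k i := by
      have h2 : Y * G = V := by rw [hG, ← Matrix.mul_assoc, hY', Matrix.one_mul]
      funext j
      rw [← h2]
      rfl
    rw [h1, nsq_diagonalized hYM]
    exact Finset.sum_congr rfl fun k _ => mul_comm _ _
  have hjensen : ∀ i : Fin n, ∑ k : Fin n, (if (k : ℕ) < r then w i k * x k ^ s else 0) ≤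
      nsq (M *ᵥ fun j => V j i) ^ s := fun i => by
    have h1 := (Real.concaveOn_rpow hs0.le hs1).le_map_sum (t := Finset.univ) (w := w i) (p := x)
      (fun k _ => hw0 i k) (hrow i) (fun k _ => hx0 k)
    simp only [smul_eq_mul] at h1
    rw [hX]
    refine le_trans (Finset.sum_le_sum fun k _ => ?_) h1
    split_ifs
    · exact le_rfl
    · exact mul_nonneg (hw0 i k) (Real.rpow_nonneg (hx0 k) s)
  -- A short image leaves little weight on any singular value that is at least `√δ`.
  have hsmall : ∀ i k : Fin n, r ≤ (i : ℕ) → (k : ℕ) < r → w i k * x k ^ s ≤ K * (ε / δ) := by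
    intro i k hi hk
    have h1 : w i k * δ ≤ ε := by
      calc w i k * δ ≤ w i k * x k := mul_le_mul_of_nonneg_left (hσ k hk) (hw0 i k)
        _ ≤ ∑ k, w i k * x k := Finset.single_le_sum (f := fun k => w i k * x k)
            (fun k _ => mul_nonneg (hw0 i k) (hx0 k)) (Finset.mem_univ k)
        _ ≤ ε := by rw [← hX]; exact hε i hi
    have h2 : w i k ≤ ε / δ := (le_div_iff₀ hδ).mpr h1
    calc w i k * x k ^ s ≤ ε / δ * K :=
          mul_le_mul h2 (hK k) (Real.rpow_nonneg (hx0 k) s) ((hw0 i k).trans h2)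
      _ = _ := mul_comm _ _
  have hKε : ∀ i : Fin n, 0 ≤ K * (ε / δ) := fun i =>
    mul_nonneg ((Real.rpow_nonneg (hx0 i) s).trans (hK i)) (div_nonneg hε0 hδ.le)
  calc ∑ k : Fin n, (if (k : ℕ) < r then x k ^ s else 0)
      = ∑ k : Fin n, ∑ i : Fin n, (if (k : ℕ) < r then w i k * x k ^ s else 0) := by
        refine Finset.sum_congr rfl fun k _ => ?_
        split_ifs
        · rw [← Finset.sum_mul, hcol, one_mul]
        · simp
    _ = ∑ i : Fin n, ∑ k : Fin n, (if (k : ℕ) < r then w i k * x k ^ s else 0) :=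
        Finset.sum_comm
    _ ≤ ∑ i : Fin n, ((if (i : ℕ) < r then nsq (M *ᵥ fun j => V j i) ^ s else 0) +
          n * (K * (ε / δ))) := by
        refine Finset.sum_le_sum fun i _ => ?_
        by_cases hi : (i : ℕ) < r
        · rw [if_pos hi]
          exact (hjensen i).trans
            (le_add_of_nonneg_right (mul_nonneg (Nat.cast_nonneg n) (hKε i)))
        · rw [if_neg hi, zero_add]
          calc _ ≤ ∑ k : Fin n, K * (ε / δ) := Finset.sum_le_sum fun k _ => by
                split_ifs with hk
                · exact hsmall i k (not_lt.mp hi) hk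
                · exact hKε i
            _ = _ := by simp
    _ = _ := by
        rw [Finset.sum_add_distrib]
        simp
        ring

/-- Midpoint concavity followed by Bernoulli. Here `a` and `b` will be squared lengths at `t` and
`-t`; the parallelogram law leaves only `y = O(t^2)` in their mean. -/
theorem rpow_add_rpow_le {s a b m y : ℝ} (hs0 : 0 < s) (hs1 : s ≤ 1) (ha : 0 ≤ a) (hb : 0 ≤ b)
    (hm : 0 < m) (hy : 0 ≤ y) (hab : a + b = 2 * (m + y)) :
    a ^ s + b ^ s ≤ 2 * m ^ s + 2 * (s * m ^ (s - 1)) * y := by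
  have h1 := (Real.concaveOn_rpow hs0.le hs1).2 ha hb
    (by norm_num : (0 : ℝ) ≤ 1 / 2) (by norm_num : (0 : ℝ) ≤ 1 / 2) (by norm_num)
  simp only [smul_eq_mul] at h1
  rw [show 1 / 2 * a + 1 / 2 * b = m * (1 + y / m) by field_simp; linarith,
    Real.mul_rpow hm.le (by positivity)] at h1
  have h2 := rpow_one_add_le_one_add_mul_self (s := y / m) (by linarith [div_nonneg hy hm.le])
    hs0.le hs1
  have h3 := mul_le_mul_of_nonneg_left h2 (Real.rpow_nonneg hm.le s)
  have h4 : m ^ s * (1 + s * (y / m)) = m ^ s + s * m ^ (s - 1) * y := by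
    rw [Real.rpow_sub_one hm.ne']
    ring
  linarith

namespace PencilExpansion

variable {A B : Matrix (Fin n) (Fin n) ℂ} (E : PencilExpansion A B)

theorem tendsto_base {k : ℕ} (hk : k < E.baseRank) :
    Tendsto (fun z : ℂ => singVal (A + z • B) k) (𝓝[≠] 0) (𝓝 (E.c k)) := by
  have h := (E.tendsto k (hk.trans_le E.base_le)).mul_const (E.c k)
  have hc := E.c_pos k (hk.trans_le E.base_le)
  rw [one_mul] at h
  refine h.congr fun z => ?_
  rw [E.e_eq_zero k hk, zpow_zero, mul_one, div_mul_cancel₀ _ hc.ne']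

/-- The large singular values do not grow to first order on average over `t` and `-t`. -/
theorem exists_average_base_le {p : ℝ} (hp0 : 0 < p) (hp2 : p ≤ 2) :
    ∃ C : ℝ, ∀ᶠ t : ℝ in 𝓝[>] 0,
      ∑ k ∈ Finset.range E.baseRank,
        (singVal (A + (t : ℂ) • B) k ^ p + singVal (A + (-t : ℂ) • B) k ^ p) ≤
      2 * ∑ k ∈ Finset.range E.baseRank, E.c k ^ p + C * t ^ 2 := by
  set r := E.baseRank with hr
  have hrn : r ≤ n := E.base_le.trans E.generic_le
  rcases Nat.eq_zero_or_pos r with hr0 | hrpos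
  · exact ⟨0, by simp [hr0]⟩
  obtain ⟨V, hV, hVA⟩ := exists_singVal_basis A
  have hcpos : ∀ k < r, 0 < E.c k := fun k hk => E.c_pos k (hk.trans_le E.base_le)
  -- Half the smallest nonzero singular value of `A`, squared: by continuity a lower bound for the
  -- first `r` squared singular values near `0`.
  set δ : ℝ := (E.c (r - 1) / 2) ^ 2 with hδdef
  have hδ : 0 < δ := by
    have := hcpos (r - 1) (by omega)
    positivity
  -- The parallelogram law concerns squares, so the powers are taken of squared singular values; `p
  -- ≤ 2` makes `x ^ s` concave.
  set s : ℝ := p / 2 with hs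
  have hs0 : 0 < s := by positivity
  have hs1 : s ≤ 1 := by rw [hs]; linarith
  have hps : ∀ x : ℝ, 0 ≤ x → (x ^ 2) ^ s = x ^ p := fun x hx => by
    rw [← Real.rpow_natCast, ← Real.rpow_mul hx]
    congr 1
    rw [hs]
    push_cast
    ring
  set K : ℝ := ((2 * E.c 0) ^ 2) ^ s with hK
  let v : Fin n → Fin n → ℂ := fun i j => V j i
  have hAv : ∀ i, nsq (A *ᵥ v i) = singVal A i ^ 2 := fun i => by
    have h1 : v i = V *ᵥ Pi.single i 1 := by
      rw [mulVec_single_one]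
      rfl
    rw [h1, nsq_diagonalized hVA, Finset.sum_eq_single i]
    · simp
    · intro j _ hj
      simp [hj]
    · simp
  set h : ℝ := ∑ i, nsq (B *ᵥ v i) with hh
  have hBv : ∀ i, nsq (B *ᵥ v i) ≤ h := fun i =>
    Finset.single_le_sum (f := fun i => nsq (B *ᵥ v i)) (fun _ _ => nsq_nonneg _)
      (Finset.mem_univ i)
  have hh0 : 0 ≤ h := Finset.sum_nonneg fun _ _ => nsq_nonneg _
  have hMv : ∀ (z : ℂ) i, (A + z • B) *ᵥ v i = A *ᵥ v i + z • (B *ᵥ v i) := fun z i => by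
    rw [add_mulVec, smul_mulVec]
  have hev : ∀ᶠ z in 𝓝[≠] (0 : ℂ),
      ∑ k : Fin n, (if (k : ℕ) < r then (singVal (A + z • B) k ^ 2) ^ s else 0) ≤
      ∑ i : Fin n, (if (i : ℕ) < r then nsq ((A + z • B) *ᵥ v i) ^ s else 0) +
        n * n * (K * (‖z‖ ^ 2 * h / δ)) := by
    have h1 := (E.tendsto_base (k := r - 1) (by omega)).eventually
      (lt_mem_nhds (half_lt_self (hcpos (r - 1) (by omega))))
    have h2 := (E.tendsto_base (k := 0) hrpos).eventually
      (gt_mem_nhds (show E.c 0 < 2 * E.c 0 by linarith [hcpos 0 hrpos]))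
    filter_upwards [h1, h2] with z hz1 hz2
    refine sum_rpow_singVal_le (A + z • B) V hV r hs0 hs1 hδ (by positivity) ?_ ?_ ?_
    · intro k hk
      have h3 : singVal (A + z • B) (r - 1) ≤ singVal (A + z • B) k :=
        singVal_antitone _ (by omega)
      have := hcpos (r - 1) (by omega)
      exact pow_le_pow_left₀ (by positivity) (hz1.le.trans h3) 2
    · intro k
      have h3 : singVal (A + z • B) k ≤ singVal (A + z • B) 0 := singVal_antitone _ (by omega)
      exact Real.rpow_le_rpow (by positivity)
        (pow_le_pow_left₀ (singVal_nonneg _ _) (h3.trans hz2.le) 2) hs0.le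
    · intro i hi
      have h3 : nsq (A *ᵥ v i) = 0 := by
        rw [hAv, E.singVal_eq_zero i hi i.2]
        simp
      have h4 : A *ᵥ v i = 0 := by
        funext j
        have := (Finset.sum_eq_zero_iff_of_nonneg fun _ _ => by positivity).mp h3 j
          (Finset.mem_univ j)
        simpa using this
      have h5 := hMv z i
      rw [h4, zero_add] at h5
      change nsq ((A + z • B) *ᵥ v i) ≤ _
      rw [h5, nsq_smul]
      exact mul_le_mul_of_nonneg_left (hBv i) (by positivity)
  have hpl := tendsto_ofReal_nhdsGT.eventually hev
  have hneg : Tendsto (fun t : ℝ => (-t : ℂ)) (𝓝[>] 0) (𝓝[≠] 0) := by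
    refine tendsto_nhdsWithin_iff.mpr ⟨?_, ?_⟩
    · exact (Complex.continuous_ofReal.neg.tendsto' 0 0 (by simp)).mono_left nhdsWithin_le_nhds
    · filter_upwards [self_mem_nhdsWithin] with t ht
      simpa using (ne_of_gt ht)
  have hmi := hneg.eventually hev
  refine ⟨∑ i : Fin n, (if (i : ℕ) < r then
    2 * (s * (singVal A i ^ 2) ^ (s - 1)) * nsq (B *ᵥ v i) else 0) +
    2 * (n * n * (K * (h / δ))), ?_⟩
  filter_upwards [hpl, hmi] with t h1 h2
  have hsum : ∀ M : Matrix (Fin n) (Fin n) ℂ, ∑ k ∈ Finset.range r, singVal M k ^ p =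
      ∑ k : Fin n, (if (k : ℕ) < r then (singVal M k ^ 2) ^ s else 0) := fun M => by
    rw [Fin.sum_univ_eq_sum_range (fun k => if k < r then (singVal M k ^ 2) ^ s else 0) n,
      ← Finset.sum_filter]
    refine Finset.sum_congr ?_ fun k _ => (hps _ (singVal_nonneg _ _)).symm
    ext k
    simp only [Finset.mem_range, Finset.mem_filter]
    omega
  have hc : ∑ k ∈ Finset.range r, E.c k ^ p = ∑ k ∈ Finset.range r, singVal A k ^ p :=
    Finset.sum_congr rfl fun k hk => by rw [E.c_eq k (Finset.mem_range.mp hk)]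
  rw [hc, Finset.sum_add_distrib, hsum, hsum, hsum]
  have hX : ∑ i : Fin n, (if (i : ℕ) < r then nsq ((A + (t : ℂ) • B) *ᵥ v i) ^ s else 0) +
      ∑ i : Fin n, (if (i : ℕ) < r then nsq ((A + (-t : ℂ) • B) *ᵥ v i) ^ s else 0) ≤
      2 * ∑ i : Fin n, (if (i : ℕ) < r then (singVal A i ^ 2) ^ s else 0) +
      (∑ i : Fin n, (if (i : ℕ) < r then
        2 * (s * (singVal A i ^ 2) ^ (s - 1)) * nsq (B *ᵥ v i) else 0)) * t ^ 2 := by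
    rw [← Finset.sum_add_distrib, Finset.mul_sum, Finset.sum_mul, ← Finset.sum_add_distrib]
    refine Finset.sum_le_sum fun i _ => ?_
    split_ifs with hi
    · have h3 : 0 < singVal A i := by
        rw [← E.c_eq i hi]
        exact hcpos i hi
      have h4 : nsq ((A + (t : ℂ) • B) *ᵥ v i) + nsq ((A + (-t : ℂ) • B) *ᵥ v i) =
          2 * (singVal A i ^ 2 + t ^ 2 * nsq (B *ᵥ v i)) := by
        rw [hMv, hMv, neg_smul, ← sub_eq_add_neg, nsq_add_add_nsq_sub, nsq_smul, hAv,
          Complex.norm_real, Real.norm_eq_abs, sq_abs]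
      have h5 := rpow_add_rpow_le hs0 hs1 (nsq_nonneg _) (nsq_nonneg _) (by positivity)
        (mul_nonneg (sq_nonneg t) (nsq_nonneg _)) h4
      linarith
    · simp
  simp only [norm_neg, Complex.norm_real, Real.norm_eq_abs, sq_abs] at h1 h2
  have h6 : (n : ℝ) * n * (K * (t ^ 2 * h / δ)) = n * n * (K * (h / δ)) * t ^ 2 := by ring
  rw [h6] at h1 h2
  linarith

end PencilExpansion

/-! ### Growth of the pencil and its exponents -/

/-- The `p`-th power of the Schatten `p`-quasi-norm of the pencil `A + z • B`. -/
noncomputable def pencilPow (p : ℝ) (A B : Matrix (Fin n) (Fin n) ℂ) (z : ℂ) : ℝ :=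
  ∑ i : Fin n, singVal (A + z • B) i ^ p

namespace PencilExpansion

variable {A B : Matrix (Fin n) (Fin n) ℂ} (E : PencilExpansion A B)

/-- The contribution of the singular values that vanish at `0`. -/
noncomputable def smallPart (p t : ℝ) : ℝ :=
  ∑ k ∈ Finset.Ico E.baseRank E.genericRank, (E.c k * t ^ E.e k) ^ p

theorem pencilPow_zero {p : ℝ} (hp : 0 < p) :
    pencilPow p A B 0 = ∑ k ∈ Finset.range E.baseRank, E.c k ^ p := by
  rw [pencilPow, zero_smul, add_zero, Fin.sum_univ_eq_sum_range (fun k => singVal A k ^ p) n]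
  symm
  refine (Finset.sum_congr rfl fun k hk => by rw [E.c_eq k (Finset.mem_range.mp hk)]).trans
    (Finset.sum_subset (Finset.range_mono (E.base_le.trans E.generic_le)) fun k hk hk' => ?_)
  rw [E.singVal_eq_zero k (by simpa using hk') (Finset.mem_range.mp hk), Real.zero_rpow hp.ne']

/-- The bound is asserted at one point of each circle only. This suffices against upper bounds that
hold on whole circles. -/
theorem exists_pencilPow_ge {p : ℝ} (hp : 0 < p) :
    ∀ᶠ t in 𝓝[>] (0 : ℝ), ∃ z : ℂ, ‖z‖ = t ∧
      pencilPow p A B 0 + E.smallPart p t ≤ pencilPow p A B z := by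
  filter_upwards [E.lower p hp] with t ⟨z, hz, h⟩
  refine ⟨z, hz, le_trans (le_of_eq ?_) h⟩
  rw [E.pencilPow_zero hp, smallPart, ← Finset.sum_range_add_sum_Ico _ E.base_le]
  congr 1
  exact Finset.sum_congr rfl fun k hk => by
    rw [E.e_eq_zero k (Finset.mem_range.mp hk), zpow_zero, mul_one]

theorem eventually_rpow_le {p ε : ℝ} (hp : 0 < p) (hε : 0 < ε) :
    ∀ᶠ z in 𝓝[≠] (0 : ℂ), ∑ k ∈ Finset.Ico E.baseRank n, singVal (A + z • B) k ^ p ≤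
      (1 + ε) * E.smallPart p ‖z‖ := by
  have h1 : ∀ᶠ z in 𝓝[≠] (0 : ℂ), ∀ k ∈ Finset.Ico E.genericRank n,
      singVal (A + z • B) k = 0 :=
    (Finset.eventually_all _).mpr fun k hk =>
      E.vanish k (Finset.mem_Ico.mp hk).1 (Finset.mem_Ico.mp hk).2
  have h2 : ∀ᶠ z in 𝓝[≠] (0 : ℂ), ∀ k ∈ Finset.Ico E.baseRank E.genericRank,
      singVal (A + z • B) k ^ p ≤ (1 + ε) * (E.c k * ‖z‖ ^ E.e k) ^ p := by
    refine (Finset.eventually_all _).mpr fun k hk => ?_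
    have hk := (Finset.mem_Ico.mp hk).2
    have h3 := (E.tendsto k hk).rpow_const (p := p) (Or.inl one_ne_zero)
    rw [Real.one_rpow] at h3
    filter_upwards [h3.eventually (gt_mem_nhds (show 1 < 1 + ε by linarith)),
      eventually_mem_nhdsWithin] with z hz hz0
    have hpos : 0 < E.c k * ‖z‖ ^ E.e k :=
      mul_pos (E.c_pos k hk) (zpow_pos (norm_pos_iff.mpr hz0) _)
    rw [Real.div_rpow (singVal_nonneg _ _) hpos.le, div_lt_iff₀ (Real.rpow_pos_of_pos hpos p)] at hz
    exact hz.le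
  filter_upwards [h1, h2] with z hz1 hz2
  have h3 : ∑ k ∈ Finset.Ico E.genericRank n, singVal (A + z • B) k ^ p = 0 :=
    Finset.sum_eq_zero fun k hk => by rw [hz1 k hk, Real.zero_rpow hp.ne']
  rw [← Finset.sum_Ico_consecutive _ E.base_le E.generic_le, h3, add_zero, smallPart,
    Finset.mul_sum]
  exact Finset.sum_le_sum hz2

/-- The large singular values contribute the `t ^ 2` term, the vanishing ones at most `1 + ε` times
their monomials. -/
theorem exists_pencilPow_average_le {p ε : ℝ} (hp0 : 0 < p) (hp2 : p ≤ 2) (hε : 0 < ε) :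
    ∃ C : ℝ, ∀ᶠ t : ℝ in 𝓝[>] 0, pencilPow p A B t + pencilPow p A B (-t) ≤
      2 * pencilPow p A B 0 + C * t ^ 2 + 2 * (1 + ε) * E.smallPart p t := by
  obtain ⟨C, hC⟩ := E.exists_average_base_le hp0 hp2
  refine ⟨C, ?_⟩
  have hneg : Tendsto (fun t : ℝ => (-t : ℂ)) (𝓝[>] 0) (𝓝[≠] 0) := by
    refine tendsto_nhdsWithin_iff.mpr ⟨?_, ?_⟩
    · exact (Complex.continuous_ofReal.neg.tendsto' 0 0 (by simp)).mono_left nhdsWithin_le_nhds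
    · filter_upwards [self_mem_nhdsWithin] with t ht
      simpa using (ne_of_gt ht)
  filter_upwards [hC, tendsto_ofReal_nhdsGT.eventually (E.eventually_rpow_le hp0 hε),
    hneg.eventually (E.eventually_rpow_le hp0 hε), eventually_mem_nhdsWithin] with t h1 h2 h3 ht
  have ht : 0 < t := ht
  rw [norm_neg, Complex.norm_real, Real.norm_eq_abs, abs_of_pos ht] at h3
  rw [Complex.norm_real, Real.norm_eq_abs, abs_of_pos ht] at h2
  have hsplit : ∀ z, pencilPow p A B z =
      ∑ k ∈ Finset.range E.baseRank, singVal (A + z • B) k ^ p +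
        ∑ k ∈ Finset.Ico E.baseRank n, singVal (A + z • B) k ^ p := fun z => by
    rw [Finset.sum_range_add_sum_Ico _ (E.base_le.trans E.generic_le), pencilPow,
      Fin.sum_univ_eq_sum_range (fun k => singVal (A + z • B) k ^ p) n]
  rw [Finset.sum_add_distrib, ← E.pencilPow_zero hp0] at h1
  rw [hsplit t, hsplit (-t)]
  linarith

theorem smallPart_eq (p : ℝ) {t : ℝ} (ht : 0 < t) :
    E.smallPart p t = ∑ k ∈ Finset.Ico E.baseRank E.genericRank,
      E.c k ^ p * t ^ (p * E.e k) := by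
  refine Finset.sum_congr rfl fun k hk => ?_
  rw [Real.mul_rpow (E.c_pos k (Finset.mem_Ico.mp hk).2).le (zpow_pos ht _).le,
    ← Real.rpow_intCast, ← Real.rpow_mul ht.le, mul_comm p]

/-- A bound `O(t ^ κ)` for the growth of the pencil bounds the exponents below. -/
theorem le_exponent {p κ K : ℝ} (hp : 0 < p)
    (hF : ∀ᶠ t in 𝓝[>] (0 : ℝ), ∀ z : ℂ, ‖z‖ = t →
      pencilPow p A B z ≤ pencilPow p A B 0 + K * t ^ κ) :
    ∀ k ∈ Finset.Ico E.baseRank E.genericRank, κ ≤ p * E.e k := by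
  intro k hk
  by_contra! hlt
  have hck : 0 < E.c k ^ p := Real.rpow_pos_of_pos (E.c_pos k (Finset.mem_Ico.mp hk).2) p
  have hlim : Tendsto (fun t : ℝ => K * t ^ (κ - p * E.e k)) (𝓝[>] 0) (𝓝 (K * 0)) := by
    have h := Real.continuousAt_rpow_const 0 (κ - p * E.e k) (Or.inr (by linarith))
    have h' := h.tendsto
    rw [Real.zero_rpow (by linarith)] at h'
    exact (h'.mono_left nhdsWithin_le_nhds).const_mul K
  have hle : ∀ᶠ t in 𝓝[>] (0 : ℝ), E.c k ^ p ≤ K * t ^ (κ - p * E.e k) := by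
    filter_upwards [E.exists_pencilPow_ge hp, hF, eventually_mem_nhdsWithin] with t ⟨z, hz, h1⟩ h2 ht
    have ht : 0 < t := ht
    have h3 : E.smallPart p t ≤ K * t ^ κ := by linarith [h2 z hz]
    have h4 : E.c k ^ p * t ^ (p * E.e k) ≤ E.smallPart p t := by
      rw [E.smallPart_eq p ht]
      exact Finset.single_le_sum (f := fun k => E.c k ^ p * t ^ (p * E.e k))
        (fun j hj => mul_nonneg
          (Real.rpow_nonneg (E.c_pos j (Finset.mem_Ico.mp hj).2).le p) (Real.rpow_nonneg ht.le _)) hk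
    rw [Real.rpow_sub ht, ← mul_div_assoc, le_div_iff₀ (Real.rpow_pos_of_pos ht _)]
    linarith
  have := ge_of_tendsto hlim hle
  linarith

/-- The coefficient of `t ^ κ` in the contribution of the small singular values. -/
noncomputable def coeffAt (p κ : ℝ) : ℝ :=
  ∑ k ∈ Finset.Ico E.baseRank E.genericRank, if p * E.e k = κ then E.c k ^ p else 0

theorem coeffAt_mul_le {p κ t : ℝ} (ht : 0 < t) : E.coeffAt p κ * t ^ κ ≤ E.smallPart p t := by
  rw [E.smallPart_eq p ht, coeffAt, Finset.sum_mul]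
  refine Finset.sum_le_sum fun k hk => ?_
  split_ifs with h
  · rw [h]
  · rw [zero_mul]
    exact mul_nonneg (Real.rpow_nonneg (E.c_pos k (Finset.mem_Ico.mp hk).2).le p)
      (Real.rpow_nonneg ht.le _)

theorem tendsto_smallPart_div {p κ : ℝ}
    (h : ∀ k ∈ Finset.Ico E.baseRank E.genericRank, κ ≤ p * E.e k) :
    Tendsto (fun t => E.smallPart p t / t ^ κ) (𝓝[>] 0) (𝓝 (E.coeffAt p κ)) := by
  have h1 : Tendsto (fun t : ℝ => ∑ k ∈ Finset.Ico E.baseRank E.genericRank,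
      E.c k ^ p * t ^ (p * E.e k - κ)) (𝓝[>] 0) (𝓝 (E.coeffAt p κ)) := by
    refine tendsto_finsetSum _ fun k hk => ?_
    have h2 := (Real.continuousAt_rpow_const 0 (p * E.e k - κ)
      (Or.inr (by linarith [h k hk]))).tendsto.mono_left (nhdsWithin_le_nhds (s := Set.Ioi 0))
    have h3 := h2.const_mul (E.c k ^ p)
    split_ifs with h4
    · simp only [h4, sub_self, Real.rpow_zero, mul_one]
      exact tendsto_const_nhds
    · rwa [Real.zero_rpow (sub_ne_zero.mpr h4), mul_zero] at h3
  refine h1.congr' ?_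
  filter_upwards [eventually_mem_nhdsWithin] with t ht
  have ht : 0 < t := ht
  rw [E.smallPart_eq p ht, Finset.sum_div]
  refine Finset.sum_congr rfl fun k _ => ?_
  rw [Real.rpow_sub ht, mul_div_assoc]

/-- Growth of order `t ^ κ` with `κ < 2` is produced by the small singular values only. -/
theorem le_coeffAt {p κ L : ℝ} (hp0 : 0 < p) (hp2 : p ≤ 2) (hκ : κ < 2)
    (h : ∀ k ∈ Finset.Ico E.baseRank E.genericRank, κ ≤ p * E.e k)
    (hL : Tendsto (fun t : ℝ =>
      (pencilPow p A B t + pencilPow p A B (-t) - 2 * pencilPow p A B 0) / t ^ κ)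
      (𝓝[>] 0) (𝓝 (2 * L))) : L ≤ E.coeffAt p κ := by
  have hε : ∀ ε : ℝ, 0 < ε → 2 * L ≤ 2 * (1 + ε) * E.coeffAt p κ := by
    intro ε hε
    obtain ⟨C, hC⟩ := E.exists_pencilPow_average_le hp0 hp2 hε
    -- Since `κ < 2`, the contribution of the large singular values disappears after division by `t
    -- ^ κ`.
    have h1 : Tendsto (fun t : ℝ => C * t ^ (2 - κ) + 2 * (1 + ε) * (E.smallPart p t / t ^ κ))
        (𝓝[>] 0) (𝓝 (C * 0 + 2 * (1 + ε) * E.coeffAt p κ)) := by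
      refine Tendsto.add (Tendsto.const_mul C ?_) ((E.tendsto_smallPart_div h).const_mul _)
      have h2 := (Real.continuousAt_rpow_const 0 (2 - κ)
        (Or.inr (by linarith))).tendsto.mono_left (nhdsWithin_le_nhds (s := Set.Ioi 0))
      rwa [Real.zero_rpow (by linarith)] at h2
    rw [mul_zero, zero_add] at h1
    refine le_of_tendsto_of_tendsto hL h1 ?_
    filter_upwards [hC, eventually_mem_nhdsWithin] with t h2 ht
    have ht : 0 < t := ht
    have h3 : 0 < t ^ κ := Real.rpow_pos_of_pos ht κ
    rw [Real.rpow_sub ht, Real.rpow_two, ← mul_div_assoc, ← mul_div_assoc, ← add_div]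
    gcongr
    linarith
  have h0 : 0 ≤ E.coeffAt p κ := Finset.sum_nonneg fun k hk => by
    split_ifs
    · exact Real.rpow_nonneg (E.c_pos k (Finset.mem_Ico.mp hk).2).le p
    · exact le_rfl
  refine le_of_forall_pos_le_add fun η hη => ?_
  have h1 := hε (η / (E.coeffAt p κ + 1)) (by positivity)
  have h2 : η / (E.coeffAt p κ + 1) * E.coeffAt p κ ≤ η := by
    rw [div_mul_eq_mul_div, div_le_iff₀ (by positivity)]
    nlinarith
  linarith

/-! ### Exponents from compressed determinants -/

/-- A compressed determinant of order `d` at `0` bounds the first small exponent. -/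
theorem exponent_le_of_det {κ : Type*} [Fintype κ] [DecidableEq κ]
    (hκ : Fintype.card κ = E.baseRank + 1) {W U : Matrix (Fin n) κ ℂ} (hW : Wᴴ * W = 1)
    (hU : Uᴴ * U = 1) (d : ℕ) (g : ℂ → ℂ) (hg : ContinuousAt g 0) (hg0 : g 0 ≠ 0)
    (hdet : ∀ z : ℂ, (Wᴴ * (A + z • B) * U).det = z ^ d * g z) :
    E.baseRank < E.genericRank ∧ E.e E.baseRank ≤ d := by
  set r := E.baseRank with hr
  let f : Fin (r + 1) ≃ κ := (Fintype.equivFinOfCardEq hκ).symm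
  have hiso : ∀ {X : Matrix (Fin n) κ ℂ}, Xᴴ * X = 1 →
      (X.submatrix id f)ᴴ * X.submatrix id f = 1 := by
    intro X hX
    ext i j
    have := congrFun (congrFun hX (f i)) (f j)
    simpa [Matrix.mul_apply, one_apply] using this
  have hle : ∀ z : ℂ, ‖z‖ ^ d * ‖g z‖ ≤ topProd (A + z • B) (r + 1) := by
    intro z
    have h1 := norm_det_compression_le (A + z • B) (hiso hW) (hiso hU)
    have h2 : (W.submatrix id f)ᴴ * (A + z • B) * U.submatrix id f =
        (Wᴴ * (A + z • B) * U).submatrix f f := by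
      ext i j
      simp [Matrix.mul_apply]
    rwa [h2, det_submatrix_equiv_self, hdet, norm_mul, norm_pow] at h1
  have hrn : r + 1 ≤ n := isometry_card_le (hiso hW)
  have hgpos : 0 < ‖g 0‖ / 2 := half_pos (norm_pos_iff.mpr hg0)
  have hgev : ∀ᶠ z in 𝓝[≠] (0 : ℂ), ‖g 0‖ / 2 < ‖g z‖ :=
    eventually_nhdsWithin_of_eventually_nhds
      (hg.norm.eventually (lt_mem_nhds (by linarith)))
  have hne : ∀ᶠ z in 𝓝[≠] (0 : ℂ), z ≠ 0 := eventually_mem_nhdsWithin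
  have hrρ : r < E.genericRank := by
    by_contra h
    obtain ⟨z, h1, h2, h3⟩ := ((E.vanish r (not_lt.mp h) hrn).and (hgev.and hne)).exists
    have h4 := hle z
    rw [topProd_succ, h1, mul_zero] at h4
    have : 0 < ‖z‖ ^ d * ‖g z‖ := mul_pos (pow_pos (norm_pos_iff.mpr h3) d) (hgpos.trans h2)
    linarith
  refine ⟨hrρ, ?_⟩
  -- The top `baseRank` singular values have nonzero limits, so the product with the next one has
  -- order exactly `E.e r`. If this exceeded `d`, the product divided by `‖z‖ ^ d` would tend to
  -- `0`, against the bound by the determinant.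
  by_contra! hlt
  obtain ⟨m, hm⟩ := Int.eq_ofNat_of_zero_le (show 0 ≤ E.e r - d by omega)
  have hm0 : m ≠ 0 := by omega
  have hprod : Tendsto (fun z : ℂ => topProd (A + z • B) r) (𝓝[≠] 0)
      (𝓝 (∏ k ∈ Finset.range r, E.c k)) :=
    tendsto_finsetProd _ fun k hk => E.tendsto_base (Finset.mem_range.mp hk)
  have hpow : Tendsto (fun z : ℂ => E.c r * ‖z‖ ^ m) (𝓝[≠] 0) (𝓝 0) := by
    have h1 : Tendsto (fun z : ℂ => E.c r * ‖z‖ ^ m) (𝓝 0) (𝓝 (E.c r * ‖(0 : ℂ)‖ ^ m)) :=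
      ((continuous_norm.tendsto 0).pow m).const_mul _
    rw [norm_zero, zero_pow hm0, mul_zero] at h1
    exact h1.mono_left nhdsWithin_le_nhds
  have hlim := (hprod.mul (E.tendsto r hrρ)).mul hpow
  rw [mul_zero] at hlim
  have hge : ∀ᶠ z in 𝓝[≠] (0 : ℂ), ‖g 0‖ / 2 ≤ topProd (A + z • B) r *
      (singVal (A + z • B) r / (E.c r * ‖z‖ ^ E.e r)) * (E.c r * ‖z‖ ^ m) := by
    filter_upwards [hgev, hne] with z h1 h2
    have hz : 0 < ‖z‖ := norm_pos_iff.mpr h2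
    have hc := E.c_pos r hrρ
    have h3 := hle z
    rw [topProd_succ] at h3
    have h4 : E.e r = d + m := by
      have : E.e r - d = m := hm
      omega
    rw [h4, zpow_add₀ hz.ne', zpow_natCast, zpow_natCast]
    have h5 : topProd (A + z • B) r * (singVal (A + z • B) r / (E.c r * (‖z‖ ^ d * ‖z‖ ^ m))) *
        (E.c r * ‖z‖ ^ m) = topProd (A + z • B) r * singVal (A + z • B) r / ‖z‖ ^ d := by
      field_simp
    rw [h5, le_div_iff₀ (by positivity)]
    nlinarith [pow_pos hz d]
  have := ge_of_tendsto hlim hge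
  linarith

/-- The base rank is the rank of the matrix at `0`. -/
theorem rank_eq_baseRank : A.rank = E.baseRank := by
  obtain ⟨V, hV, hVA⟩ := exists_singVal_basis A
  have hV' : V * Vᴴ = 1 := mul_eq_one_comm.mp hV
  have h1 : A.rank = (diagonal fun i : Fin n => ((singVal A i ^ 2 : ℝ) : ℂ)).rank := by
    rw [← hVA, rank_mul_eq_left_of_isUnit_det, rank_mul_eq_right_of_isUnit_det,
      rank_conjTranspose_mul_self]
    · exact (isUnit_iff_isUnit_det _).mp (IsUnit.of_mul_eq_one _ hV)
    · exact (isUnit_iff_isUnit_det _).mp (IsUnit.of_mul_eq_one _ hV')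
  rw [h1, rank_diagonal, Fintype.card_subtype]
  have h2 : ∀ i : Fin n, ((singVal A i ^ 2 : ℝ) : ℂ) ≠ 0 ↔ (i : ℕ) < E.baseRank := by
    intro i
    have hi : singVal A i ≠ 0 ↔ (i : ℕ) < E.baseRank := by
      constructor
      · intro h
        by_contra h3
        exact h (E.singVal_eq_zero i (not_lt.mp h3) i.2)
      · intro h
        rw [← E.c_eq i h]
        exact (E.c_pos i (h.trans_le E.base_le)).ne'
    rw [← hi]
    simp
  simp_rw [h2]
  rw [Fin.card_filter_val_lt, min_eq_right (E.base_le.trans E.generic_le)]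

end PencilExpansion

/-! ### Schatten norms on the span of two diagonal units -/

theorem schattenNorm_eq_sum_singVal {p : ℝ≥0∞} (hp0 : p ≠ 0) (hp : p ≠ ∞)
    (M : Matrix (Fin n) (Fin n) ℂ) :
    schattenNorm p M = (∑ i : Fin n, singVal M i ^ p.toReal) ^ (1 / p.toReal) := by
  rw [schattenNorm, if_neg hp, trace_abs_rpow M (ENNReal.toReal_pos hp0 hp)]

theorem schattenNorm_diagonal {p : ℝ≥0∞} (hp0 : p ≠ 0) (hp : p ≠ ∞) (d : Fin n → ℂ) :
    schattenNorm p (diagonal d) = (∑ i, ‖d i‖ ^ p.toReal) ^ (1 / p.toReal) := by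
  rw [schattenNorm, if_neg hp, trace_abs_rpow_diagonal d (ENNReal.toReal_pos hp0 hp)]

open scoped Matrix.Norms.L2Operator in
theorem schattenNorm_top_diagonal (d : Fin n → ℂ) : schattenNorm ∞ (diagonal d) = ‖d‖ := by
  rw [schattenNorm, if_pos rfl, l2_opNorm_toEuclideanCLM, l2_opNorm_diagonal]

theorem diagUnit_add_smul (m : ℕ) (z : ℂ) : diagUnit m 0 + z • diagUnit m 1 =
    diagonal fun i : Fin m => if (i : ℕ) = 0 then 1 else if (i : ℕ) = 1 then z else 0 := by
  rw [diagUnit, diagUnit, ← diagonal_smul, diagonal_add]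
  congr 1
  funext i
  rcases i with ⟨_ | _ | i, hi⟩ <;> simp

theorem schattenNorm_diagUnit_add_smul (hm : 2 ≤ m) {q : ℝ≥0∞} (hq0 : q ≠ 0) (hq : q ≠ ∞) (z : ℂ) :
    schattenNorm q (diagUnit m 0 + z • diagUnit m 1) =
      (1 + ‖z‖ ^ q.toReal) ^ (1 / q.toReal) := by
  obtain ⟨k, rfl⟩ := Nat.exists_eq_add_of_le' hm
  have hq' := (ENNReal.toReal_pos hq0 hq).ne'
  rw [diagUnit_add_smul, schattenNorm_diagonal hq0 hq, Fin.sum_univ_succ, Fin.sum_univ_succ]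
  simp [Real.zero_rpow hq']

theorem schattenNorm_top_diagUnit_add_smul (hm : 2 ≤ m) (z : ℂ) :
    schattenNorm ∞ (diagUnit m 0 + z • diagUnit m 1) = max 1 ‖z‖ := by
  rw [diagUnit_add_smul, schattenNorm_top_diagonal]
  refine le_antisymm ((pi_norm_le_iff_of_nonneg (by positivity)).mpr fun i => ?_) (max_le ?_ ?_)
  · split_ifs <;> simp
  · refine le_trans (le_of_eq ?_) (norm_le_pi_norm _ (⟨0, by omega⟩ : Fin m))
    simp
  · refine le_trans (le_of_eq ?_) (norm_le_pi_norm _ (⟨1, by omega⟩ : Fin m))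
    simp

theorem pencilPow_nonneg (p : ℝ) (A B : Matrix (Fin n) (Fin n) ℂ) (z : ℂ) :
    0 ≤ pencilPow p A B z :=
  Finset.sum_nonneg fun _ _ => Real.rpow_nonneg (singVal_nonneg _ _) _

theorem pencilPow_shift (p : ℝ) (A B : Matrix (Fin n) (Fin n) ℂ) (a z : ℂ) :
    pencilPow p (A + a • B) B z = pencilPow p A B (a + z) := by
  simp only [pencilPow, add_smul, add_assoc]

theorem IsSchattenIsometry.pencilPow_eq {p q : ℝ≥0∞} (hp0 : p ≠ 0) (hp : p ≠ ∞)
    {T : Matrix (Fin m) (Fin m) ℂ →ₗ[ℂ] Matrix (Fin n) (Fin n) ℂ} (hT : IsSchattenIsometry q p T)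
    (X Y : Matrix (Fin m) (Fin m) ℂ) (z : ℂ) :
    pencilPow p.toReal (T X) (T Y) z = schattenNorm q (X + z • Y) ^ p.toReal := by
  have h := hT (X + z • Y)
  rw [map_add, map_smul, schattenNorm_eq_sum_singVal hp0 hp] at h
  change pencilPow p.toReal (T X) (T Y) z ^ (1 / p.toReal) = _ at h
  rw [← h, ← Real.rpow_mul (pencilPow_nonneg _ _ _ z),
    one_div_mul_cancel (ENNReal.toReal_pos hp0 hp).ne', Real.rpow_one]

theorem tendsto_one_add_rpow_sub_one_div (α : ℝ) :
    Tendsto (fun x : ℝ => ((1 + x) ^ α - 1) / x) (𝓝[>] 0) (𝓝 α) := by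
  have h : HasDerivAt (fun x : ℝ => x ^ α) (α * 1 ^ (α - 1)) 1 :=
    Real.hasDerivAt_rpow_const (Or.inl one_ne_zero)
  have h1 := hasDerivAt_iff_tendsto_slope_zero.mp h
  simp only [Real.one_rpow, mul_one] at h1
  refine (h1.mono_left (nhdsWithin_mono 0 fun x hx => ne_of_gt hx)).congr fun x => ?_
  rw [smul_eq_mul, inv_mul_eq_div]

theorem tendsto_rpow_nhdsGT {q : ℝ} (hq : 0 < q) :
    Tendsto (fun t : ℝ => t ^ q) (𝓝[>] 0) (𝓝[>] 0) := by
  refine tendsto_nhdsWithin_iff.mpr ⟨?_, ?_⟩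
  · have h := (Real.continuousAt_rpow_const 0 q (Or.inr hq.le)).tendsto
    rw [Real.zero_rpow hq.ne'] at h
    exact h.mono_left nhdsWithin_le_nhds
  · filter_upwards [eventually_mem_nhdsWithin] with t ht
    exact Real.rpow_pos_of_pos ht q

theorem tendsto_growth {q : ℝ} (hq : 0 < q) (α : ℝ) :
    Tendsto (fun t : ℝ => ((1 + t ^ q) ^ α - 1) / t ^ q) (𝓝[>] 0) (𝓝 α) :=
  (tendsto_one_add_rpow_sub_one_div α).comp (tendsto_rpow_nhdsGT hq)

theorem eventually_growth_le {q : ℝ} (hq : 0 < q) (α : ℝ) :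
    ∀ᶠ t in 𝓝[>] (0 : ℝ), (1 + t ^ q) ^ α ≤ 1 + (α + 1) * t ^ q := by
  filter_upwards [(tendsto_growth hq α).eventually (gt_mem_nhds (lt_add_one α)),
    eventually_mem_nhdsWithin] with t h ht
  have := (div_lt_iff₀ (Real.rpow_pos_of_pos ht q)).mp h
  linarith

/-! ### Exclusion of `q < 2` and of `q = ∞` -/

/-- No pencil of matrices spans a copy of complex `ℓ_q²` in `S_p` when `q < 2` and `q ≠ p`. -/
theorem false_of_pencilPow_eq_of_lt_two {p q : ℝ} (hp0 : 0 < p) (hp1 : p < 1) (hq0 : 0 < q)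
    (hq2 : q < 2) (hqp : q ≠ p) {A B : Matrix (Fin n) (Fin n) ℂ}
    (h : ∀ z, pencilPow p A B z = (1 + ‖z‖ ^ q) ^ (p / q)) : False := by
  obtain ⟨E⟩ := nonempty_pencilExpansion A B
  set α := p / q with hα
  have hα0 : 0 < α := div_pos hp0 hq0
  have h0 : pencilPow p A B 0 = 1 := by rw [h, norm_zero, Real.zero_rpow hq0.ne']; simp
  have hexp : ∀ k ∈ Finset.Ico E.baseRank E.genericRank, q ≤ p * E.e k := by
    refine E.le_exponent (K := α + 1) hp0 ?_
    filter_upwards [eventually_growth_le hq0 α] with t ht z hz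
    rwa [h, h0, hz]
  have hcoeff : α ≤ E.coeffAt p q := by
    refine E.le_coeffAt hp0 (by linarith) hq2 hexp ?_
    refine ((tendsto_growth hq0 α).const_mul 2).congr' ?_
    filter_upwards [eventually_mem_nhdsWithin] with t ht
    rw [h, h, h0, norm_neg, Complex.norm_real, Real.norm_eq_abs, abs_of_pos ht]
    ring
  -- For `q < p`, every small exponent satisfies `p * e ≥ p > q`, so nothing has order `t ^ q`. For
  -- `q > p`, a coefficient at least `p / q` would lift `F` to `1 + (p / q) * t ^ q`, above its
  -- actual value.
  rcases lt_or_gt_of_ne hqp with hlt | hlt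
  · have hzero : E.coeffAt p q = 0 := Finset.sum_eq_zero fun k hk => by
      have h1 := hexp k hk
      have h2 : 0 < E.e k := by
        by_contra h3
        have h4 : (E.e k : ℝ) ≤ 0 := by exact_mod_cast not_lt.mp h3
        nlinarith
      have h5 : (1 : ℝ) ≤ E.e k := by exact_mod_cast h2
      exact if_neg (by nlinarith)
    linarith
  · have hα1 : α < 1 := (div_lt_one hq0).mpr hlt
    obtain ⟨t, ⟨z, hz, h1⟩, ht⟩ :=
      ((E.exists_pencilPow_ge hp0).and eventually_mem_nhdsWithin).exists
    have ht : 0 < t := ht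
    have htq : 0 < t ^ q := Real.rpow_pos_of_pos ht q
    have h2 := rpow_one_add_lt_one_add_mul_self (s := t ^ q) (by linarith) htq.ne' hα0 hα1
    have h3 := E.coeffAt_mul_le (p := p) (κ := q) ht
    rw [h0, h, hz] at h1
    have h4 : α * t ^ q ≤ E.coeffAt p q * t ^ q := by gcongr
    linarith

/-- No pencil of matrices spans a copy of complex `ℓ_∞²` in `S_p` when `1 / p` is not an
integer. -/
theorem false_of_pencilPow_eq_max {p : ℝ} (hp0 : 0 < p) (hp1 : p < 1)
    (hpk : ∀ k : ℕ, 1 ≤ k → p ≠ (k : ℝ)⁻¹) {A B : Matrix (Fin n) (Fin n) ℂ}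
    (h : ∀ z, pencilPow p A B z = max 1 ‖z‖ ^ p) : False := by
  -- The expansion is taken at `z = 1`, on the circle where `max 1 ‖z‖` has its kink.
  obtain ⟨E⟩ := nonempty_pencilExpansion (A + (1 : ℂ) • B) B
  have h' : ∀ z, pencilPow p (A + (1 : ℂ) • B) B z = max 1 ‖1 + z‖ ^ p := fun z => by
    rw [pencilPow_shift, h]
  have h0 : pencilPow p (A + (1 : ℂ) • B) B 0 = 1 := by rw [h']; simp
  have hexp : ∀ k ∈ Finset.Ico E.baseRank E.genericRank, 1 ≤ p * E.e k := by
    refine E.le_exponent (K := p) hp0 ?_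
    filter_upwards [eventually_mem_nhdsWithin] with t ht z hz
    have ht : 0 < t := ht
    rw [h', h0, Real.rpow_one]
    have h1 : max 1 ‖1 + z‖ ≤ 1 + t := max_le (by linarith) (by
      have := norm_add_le 1 z
      rwa [norm_one, hz] at this)
    exact (Real.rpow_le_rpow (by positivity) h1 hp0.le).trans
      (rpow_one_add_le_one_add_mul_self (by linarith) hp0.le hp1.le)
  have hzero : E.coeffAt p 1 = 0 := Finset.sum_eq_zero fun k hk => if_neg fun h1 => by
    have h2 : 0 < E.e k := by
      by_contra h3
      have h4 : (E.e k : ℝ) ≤ 0 := by exact_mod_cast not_lt.mp h3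
      nlinarith
    obtain ⟨j, hj⟩ := Int.eq_ofNat_of_zero_le h2.le
    rw [hj] at h1 h2
    exact hpk j (by exact_mod_cast h2) (eq_inv_of_mul_eq_one_left (by exact_mod_cast h1))
  -- Only the step in the direction `+t` increases the maximum, so the average growth is half of `p
  -- * t`.
  have hcoeff : p / 2 ≤ E.coeffAt p 1 := by
    refine E.le_coeffAt hp0 (by linarith) (by norm_num) hexp ?_
    rw [mul_div_cancel₀ p two_ne_zero]
    refine (tendsto_one_add_rpow_sub_one_div p).congr' ?_
    filter_upwards [eventually_mem_nhdsWithin,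
      eventually_nhdsWithin_of_eventually_nhds (eventually_lt_nhds one_pos)] with t ht ht1
    have ht : 0 < t := ht
    have h1 : max 1 ‖(1 : ℂ) + (t : ℂ)‖ = 1 + t := by
      rw [← Complex.ofReal_one, ← Complex.ofReal_add, Complex.norm_real, Real.norm_eq_abs,
        abs_of_pos (by linarith)]
      exact max_eq_right (by linarith)
    have h2 : max 1 ‖(1 : ℂ) + (-t : ℂ)‖ = 1 := by
      rw [← Complex.ofReal_neg, ← Complex.ofReal_one, ← Complex.ofReal_add, Complex.norm_real,
        Real.norm_eq_abs, abs_of_pos (by linarith)]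
      exact max_eq_left (by linarith)
    rw [h', h', h0, h1, h2, Real.one_rpow, Real.rpow_one]
    ring
  linarith

/-! ### The action of `B` on the kernel of `A` -/

section EigenBasis

variable {A : Matrix (Fin n) (Fin n) ℂ} (hA : A.IsHermitian) (B : Matrix (Fin n) (Fin n) ℂ)

/-- The matrix of `B` in an orthonormal eigenbasis of `A`. -/
noncomputable def inEigenbasis : Matrix (Fin n) (Fin n) ℂ :=
  hA.eigenvectorUnitary.1ᴴ * B * hA.eigenvectorUnitary.1

theorem eigenvectorUnitary_isometry :
    hA.eigenvectorUnitary.1ᴴ * hA.eigenvectorUnitary.1 = 1 :=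
  Unitary.coe_star_mul_self hA.eigenvectorUnitary

theorem eigenvectorUnitary_coisometry :
    hA.eigenvectorUnitary.1 * hA.eigenvectorUnitary.1ᴴ = 1 :=
  Unitary.coe_mul_star_self hA.eigenvectorUnitary

theorem inEigenbasis_self :
    inEigenbasis hA A = diagonal fun i => (hA.eigenvalues i : ℂ) := by
  have h := hA.spectral_theorem
  rw [Unitary.conjStarAlgAut_apply, star_eq_conjTranspose] at h
  have hU := eigenvectorUnitary_isometry hA
  set V := hA.eigenvectorUnitary.1
  calc inEigenbasis hA A = (Vᴴ * V) * diagonal (RCLike.ofReal ∘ hA.eigenvalues) * (Vᴴ * V) :=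
        (congrArg (fun Z => Vᴴ * Z * V) h).trans (by simp only [Matrix.mul_assoc])
    _ = _ := by rw [hU]; simp

theorem inEigenbasis_isHermitian {B : Matrix (Fin n) (Fin n) ℂ} (hB : B.IsHermitian) :
    (inEigenbasis hA B).IsHermitian :=
  isHermitian_conjTranspose_mul_mul _ hB

/-- The inclusion of the indices with nonzero eigenvalue, extended by one more index. -/
def supportExtend (i : Fin n) : {i // hA.eigenvalues i ≠ 0} ⊕ Unit → Fin n :=
  Sum.elim Subtype.val fun _ => i

theorem supportExtend_injective {i : Fin n} (hi : hA.eigenvalues i = 0) :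
    Function.Injective (supportExtend hA i) := by
  rintro (a | a) (b | b) h
  · exact congrArg Sum.inl (Subtype.ext h)
  · exact absurd (congrArg hA.eigenvalues h |>.trans hi) a.2
  · exact absurd (congrArg hA.eigenvalues h.symm |>.trans hi) b.2
  · rfl

theorem isometry_supportExtend {i : Fin n} (hi : hA.eigenvalues i = 0) :
    (hA.eigenvectorUnitary.1.submatrix id (supportExtend hA i))ᴴ *
      hA.eigenvectorUnitary.1.submatrix id (supportExtend hA i) = 1 := by
  ext a b
  have := congrFun (congrFun (eigenvectorUnitary_isometry hA) (supportExtend hA i a))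
    (supportExtend hA i b)
  rw [one_apply] at this ⊢
  simp only [(supportExtend_injective hA hi).eq_iff] at this
  exact this

/-- Only the support block survives at `z = 0`. The bordering row and column are multiples of `z`,
so the order of the determinant can be read off by extracting these factors. -/
theorem compression_supportExtend (i j : Fin n) (hi : hA.eigenvalues i = 0)
    (hj : hA.eigenvalues j = 0) (z : ℂ) :
    (hA.eigenvectorUnitary.1.submatrix id (supportExtend hA i))ᴴ * (A + z • B) *
      hA.eigenvectorUnitary.1.submatrix id (supportExtend hA j) =
    fromBlocks ((diagonal fun k : {k // hA.eigenvalues k ≠ 0} => (hA.eigenvalues k : ℂ)) +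
        z • (inEigenbasis hA B).submatrix Subtype.val Subtype.val)
      (z • (inEigenbasis hA B).submatrix Subtype.val fun _ : Unit => j)
      (z • (inEigenbasis hA B).submatrix (fun _ : Unit => i) Subtype.val)
      (z • (inEigenbasis hA B).submatrix (fun _ : Unit => i) fun _ : Unit => j) := by
  have h1 : (hA.eigenvectorUnitary.1.submatrix id (supportExtend hA i))ᴴ * (A + z • B) *
      hA.eigenvectorUnitary.1.submatrix id (supportExtend hA j) =
      (inEigenbasis hA A + z • inEigenbasis hA B).submatrix (supportExtend hA i)
        (supportExtend hA j) := by
    have h2 : inEigenbasis hA A + z • inEigenbasis hA B =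
        hA.eigenvectorUnitary.1ᴴ * (A + z • B) * hA.eigenvectorUnitary.1 := by
      simp only [inEigenbasis, Matrix.mul_add, Matrix.add_mul, Matrix.mul_smul, Matrix.smul_mul]
    rw [h2]
    rfl
  rw [h1, inEigenbasis_self]
  ext (a | a) (b | b)
  · simp [supportExtend, diagonal_apply, Subtype.ext_iff]
  · have : (a : Fin n) ≠ j := fun h => a.2 (h ▸ hj)
    simp [supportExtend, this]
  · have : i ≠ (b : Fin n) := fun h => b.2 (h ▸ hi)
    simp [supportExtend, this]
  · simp [supportExtend, diagonal_apply, hi]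

theorem det_support_ne_zero :
    (diagonal fun k : {k // hA.eigenvalues k ≠ 0} => (hA.eigenvalues k : ℂ)).det ≠ 0 := by
  rw [det_diagonal]
  exact Finset.prod_ne_zero_iff.mpr fun k _ => Complex.ofReal_ne_zero.mpr k.2

theorem card_support_add_unit (E : PencilExpansion A B) :
    Fintype.card ({i // hA.eigenvalues i ≠ 0} ⊕ Unit) = E.baseRank + 1 := by
  rw [Fintype.card_sum, Fintype.card_unit, ← hA.rank_eq_card_non_zero_eigs, E.rank_eq_baseRank]

variable {B}

/-- If no small singular value has exponent `1`, then `B` compressed to the kernel of `A`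
vanishes. -/
theorem inEigenbasis_eq_zero_of_two_le (E : PencilExpansion A B)
    (hE : E.baseRank < E.genericRank → 2 ≤ E.e E.baseRank) {i j : Fin n}
    (hi : hA.eigenvalues i = 0) (hj : hA.eigenvalues j = 0) : inEigenbasis hA B i j = 0 := by
  by_contra hne
  set D := diagonal fun k : {k // hA.eigenvalues k ≠ 0} => (hA.eigenvalues k : ℂ) with hD
  set b11 := (inEigenbasis hA B).submatrix
    (Subtype.val : {k // hA.eigenvalues k ≠ 0} → Fin n)
    (Subtype.val : {k // hA.eigenvalues k ≠ 0} → Fin n) with hb11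
  set b12 := (inEigenbasis hA B).submatrix
    (Subtype.val : {k // hA.eigenvalues k ≠ 0} → Fin n) fun _ : Unit => j with hb12
  set b21 := (inEigenbasis hA B).submatrix (fun _ : Unit => i)
    (Subtype.val : {k // hA.eigenvalues k ≠ 0} → Fin n) with hb21
  set b22 := (inEigenbasis hA B).submatrix (fun _ : Unit => i) fun _ : Unit => j with hb22
  -- One factor `z` is taken from the last row. What remains at `0` is block triangular with
  -- determinant `det D` times the `i j` entry, nonzero by assumption, so the exponent would be at
  -- most `1`.
  obtain ⟨h1, h2⟩ := E.exponent_le_of_det (card_support_add_unit hA B E)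
    (isometry_supportExtend hA hi) (isometry_supportExtend hA hj) 1
    (fun z => (fromBlocks (D + z • b11) (z • b12) b21 b22).det)
    (by
      refine Continuous.continuousAt (Continuous.matrix_det ?_)
      exact Continuous.matrix_fromBlocks (by fun_prop) (by fun_prop) (by fun_prop) (by fun_prop))
    (by
      simp only [zero_smul, add_zero]
      rw [det_fromBlocks_zero₁₂]
      exact mul_ne_zero (det_support_ne_zero hA) (by simpa [hb22] using hne))
    (fun z => by
      rw [compression_supportExtend hA B i j hi hj]
      have h : fromBlocks (D + z • b11) (z • b12) (z • b21) (z • b22) =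
          fromBlocks 1 0 0 (z • (1 : Matrix Unit Unit ℂ)) *
            fromBlocks (D + z • b11) (z • b12) b21 b22 := by
        simp [fromBlocks_multiply]
      rw [← hD, ← hb11, ← hb12, ← hb21, ← hb22, h, det_mul, det_fromBlocks_zero₂₁]
      simp)
  have := hE h1
  push_cast at h2
  omega

/-- If `A` is positive semidefinite and no small singular value has exponent `1` or `2`, then `B`
vanishes on the kernel of `A`. -/
theorem inEigenbasis_eq_zero_of_three_le (hpos : A.PosSemidef) (hB : B.IsHermitian)
    (E : PencilExpansion A B) (hE : E.baseRank < E.genericRank → 3 ≤ E.e E.baseRank) (i : Fin n)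
    {j : Fin n} (hj : hA.eigenvalues j = 0) : inEigenbasis hA B i j = 0 := by
  by_cases hi : hA.eigenvalues i = 0
  · exact inEigenbasis_eq_zero_of_two_le hA E (fun h => by have := hE h; omega) hi hj
  by_contra hne
  have hjj := inEigenbasis_eq_zero_of_two_le hA E (fun h => by have := hE h; omega) hj hj
  set D := diagonal fun k : {k // hA.eigenvalues k ≠ 0} => (hA.eigenvalues k : ℂ) with hD
  set b11 := (inEigenbasis hA B).submatrix
    (Subtype.val : {k // hA.eigenvalues k ≠ 0} → Fin n)
    (Subtype.val : {k // hA.eigenvalues k ≠ 0} → Fin n) with hb11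
  set b12 := (inEigenbasis hA B).submatrix
    (Subtype.val : {k // hA.eigenvalues k ≠ 0} → Fin n) fun _ : Unit => j with hb12
  set b21 := (inEigenbasis hA B).submatrix (fun _ : Unit => j)
    (Subtype.val : {k // hA.eigenvalues k ≠ 0} → Fin n) with hb21
  have hb22 : (inEigenbasis hA B).submatrix (fun _ : Unit => j) (fun _ : Unit => j) = 0 := by
    ext
    exact hjj
  -- This is `∑ |B_kj|^2 / a_k` over the support. Semidefiniteness of `A` makes all terms
  -- nonnegative and excludes cancellation.
  have hschur : (b21 * D⁻¹ * b12).det ≠ 0 := by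
    have hDinv : D⁻¹ = diagonal fun k : {k // hA.eigenvalues k ≠ 0} =>
        ((hA.eigenvalues k : ℂ))⁻¹ := by
      refine inv_eq_right_inv ?_
      rw [hD, diagonal_mul_diagonal, ← diagonal_one]
      congr 1
      funext k
      exact mul_inv_cancel₀ (Complex.ofReal_ne_zero.mpr k.2)
    have hentry : (b21 * D⁻¹ * b12).det =
        ((∑ k : {k // hA.eigenvalues k ≠ 0},
          (hA.eigenvalues k)⁻¹ * ‖inEigenbasis hA B k j‖ ^ 2 : ℝ) : ℂ) := by
      rw [det_unique, hDinv, Matrix.mul_apply]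
      push_cast
      refine Finset.sum_congr rfl fun k _ => ?_
      rw [mul_diagonal, hb21, hb12, submatrix_apply, submatrix_apply,
        ← (inEigenbasis_isHermitian hA hB).apply j k, RCLike.star_def, ← Complex.conj_mul']
      ring
    rw [hentry, Complex.ofReal_ne_zero]
    have hev : ∀ k : {k // hA.eigenvalues k ≠ 0}, 0 < hA.eigenvalues k := fun k =>
      lt_of_le_of_ne (hpos.eigenvalues_nonneg k) (Ne.symm k.2)
    refine ne_of_gt (Finset.sum_pos' (fun k _ => ?_) ⟨⟨i, hi⟩, Finset.mem_univ _, ?_⟩)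
    · have := hev k
      positivity
    · have := hev ⟨i, hi⟩
      have := norm_pos_iff.mpr hne
      positivity
  -- With a zero corner, one factor `z` comes out of the last row and one out of the last column.
  -- The rest at `0` is `det D` times minus the Schur term.
  obtain ⟨h1, h2⟩ := E.exponent_le_of_det (card_support_add_unit hA B E)
    (isometry_supportExtend hA hj) (isometry_supportExtend hA hj) 2
    (fun z => (fromBlocks (D + z • b11) b12 b21 0).det)
    (by
      refine Continuous.continuousAt (Continuous.matrix_det ?_)
      exact Continuous.matrix_fromBlocks (by fun_prop) (by fun_prop) (by fun_prop) (by fun_prop))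
    (by
      simp only [zero_smul, add_zero]
      have hDu : IsUnit D.det := isUnit_iff_ne_zero.mpr (det_support_ne_zero hA)
      let := invertibleOfIsUnitDet D hDu
      rw [det_fromBlocks₁₁, invOf_eq_nonsing_inv, zero_sub, det_neg]
      exact mul_ne_zero (det_support_ne_zero hA) (mul_ne_zero (by simp) hschur))
    (fun z => by
      rw [compression_supportExtend hA B j j hj hj, hb22, smul_zero]
      have h : fromBlocks (D + z • b11) (z • b12) (z • b21) 0 =
          fromBlocks 1 0 0 (z • (1 : Matrix Unit Unit ℂ)) *
            fromBlocks (D + z • b11) b12 b21 0 *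
            fromBlocks 1 0 0 (z • (1 : Matrix Unit Unit ℂ)) := by
        simp [fromBlocks_multiply]
      rw [← hD, ← hb11, ← hb12, ← hb21, h, det_mul, det_mul, det_fromBlocks_zero₂₁]
      simp
      ring)
  have := hE h1
  push_cast at h2
  omega

/-- The quadratic form of `B` vanishes on the kernel of `A` if no exponent `1` occurs. -/
theorem dotProduct_mulVec_eq_zero_of_two_le (hA : A.IsHermitian) (E : PencilExpansion A B)
    (hE : E.baseRank < E.genericRank → 2 ≤ E.e E.baseRank) {u : Fin n → ℂ} (hu : A *ᵥ u = 0) :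
    star u ⬝ᵥ (B *ᵥ u) = 0 := by
  set V := hA.eigenvectorUnitary.1 with hV
  set x := Vᴴ *ᵥ u with hx
  have hux : V *ᵥ x = u := by
    rw [hx, mulVec_mulVec, eigenvectorUnitary_coisometry, one_mulVec]
  have hDx : ∀ i, (hA.eigenvalues i : ℂ) * x i = 0 := by
    intro i
    have h1 : inEigenbasis hA A *ᵥ x = 0 := by
      rw [inEigenbasis, ← hV, ← mulVec_mulVec, ← mulVec_mulVec, hux, hu, mulVec_zero]
    rw [inEigenbasis_self] at h1
    have := congrFun h1 i
    rwa [mulVec_diagonal] at this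
  have h2 : star u ⬝ᵥ (B *ᵥ u) = star x ⬝ᵥ (inEigenbasis hA B *ᵥ x) := by
    rw [← hux, inEigenbasis, ← hV, star_mulVec, ← dotProduct_mulVec, mulVec_mulVec, mulVec_mulVec,
      Matrix.mul_assoc]
  rw [h2, dotProduct]
  refine Finset.sum_eq_zero fun i _ => ?_
  by_cases hi : hA.eigenvalues i = 0
  · have : (inEigenbasis hA B *ᵥ x) i = 0 := by
      rw [mulVec, dotProduct]
      refine Finset.sum_eq_zero fun j _ => ?_
      by_cases hj : hA.eigenvalues j = 0
      · rw [inEigenbasis_eq_zero_of_two_le hA E hE hi hj, zero_mul]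
      · rw [(mul_eq_zero.mp (hDx j)).resolve_left (Complex.ofReal_ne_zero.mpr hj), mul_zero]
    rw [this, mul_zero]
  · rw [Pi.star_apply, (mul_eq_zero.mp (hDx i)).resolve_left (Complex.ofReal_ne_zero.mpr hi),
      star_zero, zero_mul]

/-- If `A ≥ 0` and `B ≠ 0` vanishes on the kernel of `A`, then some pencil member `A + t • B`
with real `t ≠ 0` has a kernel vector on which the form of `B` does not vanish. -/
theorem exists_degenerate_of_posSemidef (hpos : A.PosSemidef) (hB : B.IsHermitian) (hB0 : B ≠ 0)
    (hker : ∀ i j, hA.eigenvalues j = 0 → inEigenbasis hA B i j = 0) :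
    ∃ t : ℝ, t ≠ 0 ∧ ∃ u : Fin n → ℂ, (A + (t : ℂ) • B) *ᵥ u = 0 ∧ star u ⬝ᵥ (B *ᵥ u) ≠ 0 := by
  set a := hA.eigenvalues with ha
  set B' := inEigenbasis hA B with hB'
  have hB'h : B'.IsHermitian := inEigenbasis_isHermitian hA hB
  have hker' : ∀ i j, a i = 0 → B' i j = 0 := fun i j hi => by
    rw [← hB'h.apply, hker j i hi, star_zero]
  have ha0 : ∀ i, 0 ≤ a i := fun i => hpos.eigenvalues_nonneg i
  set s : Fin n → ℂ := fun i => ((√(a i) : ℝ) : ℂ) with hs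
  have hs0 : ∀ i, a i ≠ 0 → s i ≠ 0 := fun i hi =>
    Complex.ofReal_ne_zero.mpr (Real.sqrt_ne_zero'.mpr (lt_of_le_of_ne (ha0 i) hi.symm))
  have hss : ∀ i, s i * s i = a i := fun i => by
    rw [hs, ← Complex.ofReal_mul, Real.mul_self_sqrt (ha0 i)]
  have hsz : ∀ i, a i = 0 → s i = 0 := fun i hi => by simp [hs, hi]
  -- The inverse square root of `A` on its support; the convention `0⁻¹ = 0` makes it vanish on the
  -- kernel.
  let R : Matrix (Fin n) (Fin n) ℂ := diagonal fun i => (s i)⁻¹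
  let C : Matrix (Fin n) (Fin n) ℂ := R * B' * R
  have hRh : Rᴴ = R := by
    simp only [R, diagonal_conjTranspose]
    congr 1
    funext i
    simp [hs]
  have hCh : C.IsHermitian := by
    have := isHermitian_conjTranspose_mul_mul R hB'h
    rwa [hRh] at this
  have hCapp : ∀ i j, C i j = (s i)⁻¹ * B' i j * (s j)⁻¹ := fun i j => by
    simp [C, R, diagonal_mul, mul_diagonal]
  have hC0 : C ≠ 0 := by
    intro hC
    apply hB0
    have h1 : B' = 0 := by
      ext i j
      by_cases hi : a i = 0
      · exact hker' i j hi
      by_cases hj : a j = 0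
      · exact hker i j hj
      have h2 := hCapp i j
      rw [hC, Matrix.zero_apply] at h2
      simpa [hs0 i hi, hs0 j hj] using h2.symm
    have h2 : hA.eigenvectorUnitary.1 * B' * hA.eigenvectorUnitary.1ᴴ = B := by
      rw [hB', inEigenbasis]
      have h3 := eigenvectorUnitary_coisometry hA
      set V := hA.eigenvectorUnitary.1
      calc V * (Vᴴ * B * V) * Vᴴ = (V * Vᴴ) * B * (V * Vᴴ) := by simp only [Matrix.mul_assoc]
        _ = B := by rw [h3, Matrix.one_mul, Matrix.mul_one]
    rw [← h2, h1, Matrix.mul_zero, Matrix.zero_mul]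
  obtain ⟨v, μ, hμ, hv0, hv⟩ := hCh.exists_eigenvector_of_ne_zero hC0
  have hμC : (μ : ℂ) ≠ 0 := Complex.ofReal_ne_zero.mpr hμ
  have hvi : ∀ i, ∑ j, C i j * v j = μ * v i := fun i => by
    have := congrFun hv i
    simpa [mulVec, dotProduct] using this
  have hvz : ∀ i, a i = 0 → v i = 0 := fun i hi => by
    have h1 := hvi i
    rw [Finset.sum_eq_zero fun j _ => by rw [hCapp, hsz i hi, _root_.inv_zero, zero_mul, zero_mul,
      zero_mul]] at h1
    exact (mul_eq_zero.mp h1.symm).resolve_left hμC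
  -- An eigenvector `v` of `C` becomes a generalised eigenvector: `B' x = μ A x`, so `A - μ⁻¹ B`
  -- annihilates it, while the form of `B` on it is `μ * nsq v`.
  set x : Fin n → ℂ := fun i => (s i)⁻¹ * v i with hx
  have hax : ∀ i, (a i : ℂ) * x i = s i * v i := fun i => by
    by_cases hi : a i = 0
    · simp [hi, hsz i hi]
    · rw [← hss, hx]
      have := hs0 i hi
      field_simp
  have hBx : ∀ i, (B' *ᵥ x) i = μ * ((a i : ℂ) * x i) := fun i => by
    by_cases hi : a i = 0
    · rw [mulVec, dotProduct, Finset.sum_eq_zero fun j _ => by rw [hker' i j hi, zero_mul]]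
      simp [hi]
    · rw [hax, mul_left_comm, ← hvi i, Finset.mul_sum, mulVec, dotProduct]
      refine Finset.sum_congr rfl fun j _ => ?_
      rw [hCapp, hx]
      have := hs0 i hi
      field_simp
  have hform : star x ⬝ᵥ (B' *ᵥ x) = μ * (nsq v : ℂ) := by
    rw [nsq_eq, dotProduct, dotProduct, Finset.mul_sum]
    refine Finset.sum_congr rfl fun i _ => ?_
    rw [hBx, hax]
    by_cases hi : a i = 0
    · simp [hvz i hi]
    · have h1 := hs0 i hi
      have h2 : star (x i) = (s i)⁻¹ * star (v i) := by
        simp [hx, hs]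
      rw [Pi.star_apply, Pi.star_apply, h2]
      field_simp
  have hnsq : (nsq v : ℂ) ≠ 0 := by
    rw [Complex.ofReal_ne_zero]
    obtain ⟨i, hi⟩ := Function.ne_iff.mp hv0
    have : 0 < ‖v i‖ := norm_pos_iff.mpr hi
    exact ne_of_gt (Finset.sum_pos' (fun _ _ => by positivity) ⟨i, Finset.mem_univ _, by positivity⟩)
  set V := hA.eigenvectorUnitary.1 with hV
  have hVV : V * Vᴴ = 1 := eigenvectorUnitary_coisometry hA
  refine ⟨-μ⁻¹, neg_ne_zero.mpr (inv_ne_zero hμ), V *ᵥ x, ?_, ?_⟩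
  · have h1 : inEigenbasis hA (A + ((-μ⁻¹ : ℝ) : ℂ) • B) *ᵥ x = 0 := by
      have h2 : inEigenbasis hA (A + ((-μ⁻¹ : ℝ) : ℂ) • B) =
          inEigenbasis hA A + ((-μ⁻¹ : ℝ) : ℂ) • B' := by
        simp only [hB', inEigenbasis, Matrix.mul_add, Matrix.add_mul, Matrix.mul_smul,
          Matrix.smul_mul]
      rw [h2, inEigenbasis_self, add_mulVec, smul_mulVec]
      funext i
      rw [Pi.add_apply, Pi.smul_apply, mulVec_diagonal, hBx, smul_eq_mul]
      push_cast
      rw [Pi.zero_apply]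
      field_simp
      simp [ha]
    calc (A + ((-μ⁻¹ : ℝ) : ℂ) • B) *ᵥ (V *ᵥ x)
        = ((V * Vᴴ) * (A + ((-μ⁻¹ : ℝ) : ℂ) • B)) *ᵥ (V *ᵥ x) := by rw [hVV, Matrix.one_mul]
      _ = V *ᵥ (inEigenbasis hA (A + ((-μ⁻¹ : ℝ) : ℂ) • B) *ᵥ x) := by
          rw [inEigenbasis, mulVec_mulVec, mulVec_mulVec]
          simp only [Matrix.mul_assoc]
          rfl
      _ = 0 := by rw [h1, mulVec_zero]
  · have h2 : star (V *ᵥ x) ⬝ᵥ (B *ᵥ (V *ᵥ x)) = star x ⬝ᵥ (B' *ᵥ x) := by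
      rw [hB', inEigenbasis, star_mulVec, ← dotProduct_mulVec, mulVec_mulVec, mulVec_mulVec,
        Matrix.mul_assoc]
    rw [h2, hform]
    exact mul_ne_zero hμC hnsq

end EigenBasis

/-! ### Exclusion of `q ≥ 2` in the semidefinite case -/

/-- No pencil spanned by a semidefinite and a self-adjoint matrix spans a copy of complex `ℓ_q²`
in `S_p` when `q ≥ 2`. -/
theorem false_of_pencilPow_eq_of_posSemidef {p q : ℝ} (hp0 : 0 < p) (hp1 : p < 1) (hq2 : 2 ≤ q)
    {A B : Matrix (Fin n) (Fin n) ℂ} (hpos : A.PosSemidef) (hB : B.IsHermitian)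
    (h : ∀ z, pencilPow p A B z = (1 + ‖z‖ ^ q) ^ (p / q)) : False := by
  have hq0 : 0 < q := by linarith
  have hA := hpos.isHermitian
  have h0 : pencilPow p A B 0 = 1 := by rw [h, norm_zero, Real.zero_rpow hq0.ne']; simp
  have hB0 : B ≠ 0 := by
    rintro rfl
    have h1 := h 1
    have h2 : pencilPow p A 0 1 = 1 := by
      rw [← h0]
      simp [pencilPow]
    rw [h2, norm_one, Real.one_rpow] at h1
    have := Real.one_lt_rpow (show (1 : ℝ) < 1 + 1 by norm_num) (div_pos hp0 hq0)
    linarith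
  obtain ⟨E⟩ := nonempty_pencilExpansion A B
  -- From `2 ≤ q ≤ p * e` and `p < 1` the integer `e` exceeds `2`.
  have hexp : E.baseRank < E.genericRank → 3 ≤ E.e E.baseRank := by
    intro hlt
    have h1 : q ≤ p * E.e E.baseRank := by
      refine E.le_exponent (K := p / q + 1) hp0 ?_ _ (Finset.mem_Ico.mpr ⟨le_rfl, hlt⟩)
      filter_upwards [eventually_growth_le hq0 (p / q)] with t ht z hz
      rwa [h, h0, hz]
    by_contra! h2
    have h3 : (E.e E.baseRank : ℝ) ≤ 2 := by exact_mod_cast Int.lt_add_one_iff.mp h2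
    nlinarith
  obtain ⟨t, ht, u, hu, hBu⟩ := exists_degenerate_of_posSemidef hA hpos hB hB0
    fun i j hj => inEigenbasis_eq_zero_of_three_le hA hpos hB E hexp i hj
  have hA' : (A + (t : ℂ) • B).IsHermitian := by
    refine hA.add ?_
    rw [IsHermitian, conjTranspose_smul, hB.eq]
    simp
  obtain ⟨E'⟩ := nonempty_pencilExpansion (A + (t : ℂ) • B) B
  refine hBu (dotProduct_mulVec_eq_zero_of_two_le hA' E' (fun hlt => ?_) hu)
  set g : ℝ → ℝ := fun x => (1 + x ^ q) ^ (p / q) with hg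
  have htpos : 0 < |t| := abs_pos.mpr ht
  have hgd : DifferentiableAt ℝ g |t| := by
    have h1 : DifferentiableAt ℝ (fun x : ℝ => 1 + x ^ q) |t| :=
      (Real.differentiableAt_rpow_const_of_ne q htpos.ne').const_add 1
    exact h1.rpow_const (Or.inl (by positivity))
  obtain ⟨K, hK⟩ := hgd.hasDerivAt.isBigO_sub.bound
  have hgt : Tendsto (fun x : ℝ => |t| + x) (𝓝[>] 0) (𝓝 |t|) := by
    have h1 : Tendsto (fun x : ℝ => |t| + x) (𝓝 0) (𝓝 (|t| + 0)) :=
      (continuous_const.add continuous_id).tendsto 0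
    rw [add_zero] at h1
    exact h1.mono_left nhdsWithin_le_nhds
  -- The prescribed radial function is differentiable at `|t| ≠ 0`, so growth around the degenerate
  -- point is at most linear. With `p < 1` this gives `e ≥ 2`.
  have h1 : 1 ≤ p * E'.e E'.baseRank := by
    refine E'.le_exponent (K := K) hp0 ?_ _ (Finset.mem_Ico.mpr ⟨le_rfl, hlt⟩)
    filter_upwards [hgt.eventually hK, eventually_mem_nhdsWithin] with x hx hx0 z hz
    have hx0 : 0 < x := hx0
    rw [pencilPow_shift, pencilPow_shift, h, h, add_zero, Complex.norm_real, Real.norm_eq_abs,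
      Real.rpow_one]
    have h2 : ‖(t : ℂ) + z‖ ≤ |t| + x := by
      have := norm_add_le (t : ℂ) z
      rwa [Complex.norm_real, Real.norm_eq_abs, hz] at this
    have h3 : (1 + ‖(t : ℂ) + z‖ ^ q) ^ (p / q) ≤ g (|t| + x) := by
      simp only [hg]
      have : 0 ≤ p / q := by positivity
      gcongr
    rw [add_sub_cancel_left, Real.norm_eq_abs, Real.norm_eq_abs, abs_of_pos hx0] at hx
    have h4 := (le_abs_self _).trans hx
    simp only [hg] at h3 h4
    linarith
  by_contra! h2
  have h3 : (E'.e E'.baseRank : ℝ) ≤ 1 := by exact_mod_cast Int.lt_add_one_iff.mp h2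
  nlinarith

/-! ### From isometries to pencils -/

open scoped MatrixOrder in
theorem schattenNorm_neg {n : ℕ} {p : ℝ≥0∞} (hp : p ≠ ∞) (M : Matrix (Fin n) (Fin n) ℂ) :
    schattenNorm p (-M) = schattenNorm p M := by
  rw [schattenNorm, schattenNorm, if_neg hp, if_neg hp, CFC.abs_neg]

theorem IsSchattenIsometry.pencilPow_diagUnit {m n : ℕ} (hm : 2 ≤ m) {p q : ℝ≥0∞} (hp0 : p ≠ 0)
    (hp : p ≠ ∞) (hq0 : q ≠ 0) (hq : q ≠ ∞)
    {T : Matrix (Fin m) (Fin m) ℂ →ₗ[ℂ] Matrix (Fin n) (Fin n) ℂ} (hT : IsSchattenIsometry q p T)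
    (z : ℂ) : pencilPow p.toReal (T (diagUnit m 0)) (T (diagUnit m 1)) z =
      (1 + ‖z‖ ^ q.toReal) ^ (p.toReal / q.toReal) := by
  rw [hT.pencilPow_eq hp0 hp, schattenNorm_diagUnit_add_smul hm hq0 hq, ← Real.rpow_mul
    (by positivity), one_div_mul_eq_div]

/-- The norm depends on `z` only through `‖z‖`, so replacing `A` by `-A` leaves the prescribed
function unchanged; this reduces `A ≤ 0` to `A ≥ 0`. -/
theorem IsSchattenIsometry.pencilPow_neg_diagUnit {m n : ℕ} (hm : 2 ≤ m) {p q : ℝ≥0∞}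
    (hp0 : p ≠ 0) (hp : p ≠ ∞) (hq0 : q ≠ 0) (hq : q ≠ ∞)
    {T : Matrix (Fin m) (Fin m) ℂ →ₗ[ℂ] Matrix (Fin n) (Fin n) ℂ} (hT : IsSchattenIsometry q p T)
    (z : ℂ) : pencilPow p.toReal (-T (diagUnit m 0)) (T (diagUnit m 1)) z =
      (1 + ‖z‖ ^ q.toReal) ^ (p.toReal / q.toReal) := by
  rw [← map_neg, hT.pencilPow_eq hp0 hp,
    show -diagUnit m 0 + z • diagUnit m 1 = -(diagUnit m 0 + (-z) • diagUnit m 1) by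
      rw [neg_smul]; abel,
    schattenNorm_neg hq, schattenNorm_diagUnit_add_smul hm hq0 hq, ← Real.rpow_mul
    (by positivity), one_div_mul_eq_div, norm_neg]

theorem theorem1p2 (p : ℝ≥0∞) (hp0 : 0 < p) (hp1 : p < 1)
    (m n : ℕ) (hm : 2 ≤ m) (hmn : m ≤ n) :
    (∀ q : ℝ≥0∞, 0 < q → q < 2 → q ≠ 1 → q ≠ p →
      ¬ ∃ T : Matrix (Fin m) (Fin m) ℂ →ₗ[ℂ] Matrix (Fin n) (Fin n) ℂ,
        IsSchattenIsometry q p T) ∧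
    (∀ q : ℝ≥0∞, 2 ≤ q → q < ∞ →
      ¬ ∃ T : Matrix (Fin m) (Fin m) ℂ →ₗ[ℂ] Matrix (Fin n) (Fin n) ℂ,
        IsSchattenIsometry q p T ∧
        (T (diagUnit m 0)).IsHermitian ∧ (T (diagUnit m 1)).IsHermitian ∧
        ((T (diagUnit m 0)).PosSemidef ∨ (-T (diagUnit m 0)).PosSemidef)) ∧
    ((∀ k : ℕ, 1 ≤ k → p ≠ (k : ℝ≥0∞)⁻¹) →
      ¬ ∃ T : Matrix (Fin m) (Fin m) ℂ →ₗ[ℂ] Matrix (Fin n) (Fin n) ℂ,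
        IsSchattenIsometry 1 p T) ∧
    ((∀ k : ℕ, 1 ≤ k → p ≠ (k : ℝ≥0∞)⁻¹) →
      ¬ ∃ T : Matrix (Fin m) (Fin m) ℂ →ₗ[ℂ] Matrix (Fin n) (Fin n) ℂ,
        IsSchattenIsometry ∞ p T) := by
  have hptop : p ≠ ∞ := (hp1.trans ENNReal.one_lt_top).ne
  have hpr0 : 0 < p.toReal := ENNReal.toReal_pos hp0.ne' hptop
  have hpr1 : p.toReal < 1 := by
    simpa using (ENNReal.toReal_lt_toReal hptop ENNReal.one_ne_top).mpr hp1
  -- Serves every `q < 2` other than `p`, including `q = 1`, which differs from `p` because `p < 1`.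
  have hlt : ∀ q : ℝ≥0∞, 0 < q → q < 2 → q ≠ p →
      ¬ ∃ T : Matrix (Fin m) (Fin m) ℂ →ₗ[ℂ] Matrix (Fin n) (Fin n) ℂ,
        IsSchattenIsometry q p T := by
    rintro q hq0 hq2 hqp ⟨T, hT⟩
    have hqtop : q ≠ ∞ := (hq2.trans (by simp)).ne
    refine false_of_pencilPow_eq_of_lt_two hpr0 hpr1 (ENNReal.toReal_pos hq0.ne' hqtop) ?_ ?_
      (hT.pencilPow_diagUnit hm hp0.ne' hptop hq0.ne' hqtop)
    · simpa using (ENNReal.toReal_lt_toReal hqtop (by simp)).mpr hq2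
    · exact fun h => hqp ((ENNReal.toReal_eq_toReal_iff' hqtop hptop).mp h)
  refine ⟨fun q hq0 hq2 _ hqp => hlt q hq0 hq2 hqp, ?_, fun _ => hlt 1 one_pos (by simp) hp1.ne', ?_⟩
  · rintro q hq2 hq ⟨T, hT, -, hB, hA⟩
    have hq0 : q ≠ 0 := (lt_of_lt_of_le (by simp) hq2).ne'
    have hqr : 2 ≤ q.toReal := by
      simpa using (ENNReal.toReal_le_toReal (by simp) hq.ne).mpr hq2
    rcases hA with hA | hA
    · exact false_of_pencilPow_eq_of_posSemidef hpr0 hpr1 hqr hA hB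
        (hT.pencilPow_diagUnit hm hp0.ne' hptop hq0 hq.ne)
    · exact false_of_pencilPow_eq_of_posSemidef hpr0 hpr1 hqr hA hB
        (hT.pencilPow_neg_diagUnit hm hp0.ne' hptop hq0 hq.ne)
  · rintro hpk ⟨T, hT⟩
    refine false_of_pencilPow_eq_max hpr0 hpr1 (fun k hk h => hpk k hk ?_)
      (A := T (diagUnit m 0)) (B := T (diagUnit m 1)) fun z => ?_
    · rw [← ENNReal.ofReal_toReal hptop, h, ENNReal.ofReal_inv_of_pos (by exact_mod_cast hk),
        ENNReal.ofReal_natCast]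
    · rw [hT.pencilPow_eq hp0.ne' hptop, schattenNorm_top_diagUnit_add_smul hm]
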